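/- Let $\mathbb H_L$ be the hyperbolic plane of curvature $-1/L^2$ ($L>0$), i.e. the constant time slice of $\mathrm{AdS}_3$ with radius $L$, with metric $L^2(d\rho^2+\sinh^2\!\rho\,d\chi^2)$ in polar coordinates and with the circle of directions $\chi\in\mathbb R/2\pi\mathbb Z$ as its boundary at infinity. Let $\mathcal K=\{(\theta,\alpha):0\le\theta<2\pi,\ 0<\alpha<\pi\}$ be its kinematic space: $\gamma=(\theta,\alpha)$ is the oriented complete geodesic from the boundary point $u=\theta-\alpha$ to the boundary point $v=\theta+\alpha$. Let $G_N>0$, let $S(\alpha)=\frac{L}{2G_N}\log\frac{2\sin\alpha}{\epsilon}$ with a cutoff $\epsilon>0$ be the entanglement entropy of the boundary interval $[u,v]$ (the regularized length of $\gamma$ divided by $4G_N$), and let $\omega=\partial_u\partial_vS\,du\wedge dv=-\frac12\,\partial_\alpha^2S\;d\theta\wedge d\alpha$ be the Crofton form. Let $n\ge 2$, $e=4(n-1)$, and let $Q\subset\mathbb H_L$ be a closed convex hyperbolic $e$-gon, with edges labelled $1,\dots,e$ in counterclockwise order, all of whose interior angles equal $\pi/2$ (the shape of the island of an $n$-exit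 wormhole). Let $\mathcal K_Q\subset\mathcal K$ be the set of geodesics that meet $Q$, let $\lambda_Q(\gamma)$ be the length of $\gamma\cap Q$, and for $i\ne j$ let $s_{ij}\subset\mathcal K$ be the set of geodesics that enter $Q$ through the (closed) $i$-th edge and exit $Q$ through the (closed) $j$-th edge. Then $\mathcal K_Q=\bigcup_{i\neq j}s_{ij}$, and distinct sectors $s_{ij}$ overlap only in sets of measure zero. The function $\lambda_Q$ is integrable against $\omega$ on every $s_{ij}$, the sector integrals $$\mathcal I_{ij}=\frac{2G_N}{\pi}\int_{s_{ij}}\lambda_Q\,\omega\qquad(i\ne j)$$ satisfy $\mathcal I_{ij}=\mathcal I_{ji}$, and $$2\sum_{i=1}^{e}\sum_{j>i}^{e}\mathcal I_{ij}=2\pi(n-2)L^2 .$$ This sum is the area of $Q$; in particular it does not depend on the position or the shape of $Q$ (the placement of the boundary regions), but only on $n$. -/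

import Mathlib

namespace KinematicSpace

open Complex MeasureTheory Set

noncomputable section

/-!
The constant time slice is the hyperbolic plane of curvature `-1 / L ^ 2`, in the projective
(Beltrami-Klein) disk model: the point with geodesic polar coordinates `(ρ, χ)`, in which the
metric is `L ^ 2 * (dρ ^ 2 + sinh ρ ^ 2 * dχ ^ 2)`, is the point `tanh ρ * exp (χ * I)` of the open
unit disk of `ℂ`. The geodesics of this model are the straight chords of the unit circle.
-/

/-- The Riemannian metric of radius `L` at the point `x` of the disk, on tangent vectors
`v` and `w`. -/
def metric (L : ℝ) (x v w : ℂ) : ℝ :=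
  L ^ 2 * (inner ℝ v w / (1 - ‖x‖ ^ 2) + inner ℝ x v * inner ℝ x w / (1 - ‖x‖ ^ 2) ^ 2)

/-- The Riemannian volume (area) of a region of the disk: the integral of the square root of the
determinant of the metric. -/
def area (L : ℝ) (Q : Set ℂ) : ℝ :=
  ∫ x in Q, √(metric L x 1 1 * metric L x I I - metric L x 1 I ^ 2)

/-- The point of the boundary circle at angle `φ`. -/
def boundaryPoint (φ : ℝ) : ℂ := Complex.exp (φ * I)

/-- The kinematic space of oriented boundary anchored geodesics, in the coordinates
`(θ, α) = ((v + u) / 2, (v - u) / 2)`, where the geodesic runs from the boundary point at angle `u`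
to the one at angle `v`. Every ordered pair of distinct boundary points has exactly one such
pair of coordinates. -/
def kinematicSpace : Set (ℝ × ℝ) := Ico 0 (2 * Real.pi) ×ˢ Ioo 0 Real.pi

/-- The oriented geodesic with coordinates `γ = (θ, α)`, parametrized by `0 < t < 1`: the chord from
the boundary point at `u = θ - α` to the boundary point at `v = θ + α`. -/
def geodesic (γ : ℝ × ℝ) (t : ℝ) : ℂ :=
  AffineMap.lineMap (boundaryPoint (γ.1 - γ.2)) (boundaryPoint (γ.1 + γ.2)) t

/-- The parameters at which the geodesic `γ` is in `Q`. -/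
def times (Q : Set ℂ) (γ : ℝ × ℝ) : Set ℝ := {t | t ∈ Ioo (0 : ℝ) 1 ∧ geodesic γ t ∈ Q}

/-- The part of kinematic space that consists of the geodesics with nonempty intersection
with `Q`. -/
def geodesicsMeeting (Q : Set ℂ) : Set (ℝ × ℝ) :=
  {γ | γ ∈ kinematicSpace ∧ (geodesic γ '' Ioo 0 1 ∩ Q).Nonempty}

/-- The chord: the hyperbolic length of the intersection of `γ` with `Q`. -/
def chord (L : ℝ) (Q : Set ℂ) (γ : ℝ × ℝ) : ℝ :=
  ∫ t in times Q γ, √(metric L (geodesic γ t) (deriv (geodesic γ) t) (deriv (geodesic γ) t))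

/-- The entanglement entropy of a boundary interval of opening angle `α`, with UV cutoff `ε`:
`1 / (4 * G)` times the length `2 * L * log (2 * sin α / ε)` of the cut-off geodesic, equivalently
`(c / 3) * log (2 * sin α / ε)` with central charge `c = 3 * L / (2 * G)`. -/
def entropy (L G ε α : ℝ) : ℝ := L / (2 * G) * Real.log (2 * Real.sin α / ε)

/-- The density of the Crofton form `ω = ∂_u ∂_v S du ∧ dv = -(1 / 2) * ∂_α ^ 2 S dθ ∧ dα` with
respect to `dθ dα`. -/
def croftonDensity (L G ε : ℝ) (γ : ℝ × ℝ) : ℝ :=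
  -(1 / 2) * iteratedDeriv 2 (entropy L G ε) γ.2

/-- `p` lists, in counterclockwise order, the vertices of a (strictly convex) hyperbolic polygon all
of whose interior angles are right angles. The edges run from `p i` to `p (i + 1)`, cyclically; all
the other vertices are strictly to the left of the line through an edge. -/
structure IsRightAngledPolygon (L : ℝ) {e : ℕ} (p : Fin e → ℂ) : Prop where
  mem_disk : ∀ i, ‖p i‖ < 1
  convex : ∀ i j, j ≠ i → j ≠ finRotate e i →
    0 < ((starRingEnd ℂ) (p (finRotate e i) - p i) * (p j - p i)).im
  right_angle : ∀ i,
    metric L (p i) (p (finRotate e i) - p i) (p ((finRotate e).symm i) - p i) = 0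

/-- The closed region bounded by the polygon. -/
def region {e : ℕ} (p : Fin e → ℂ) : Set ℂ := convexHull ℝ (range p)

/-- The `i`-th edge, a closed geodesic segment. -/
def edge {e : ℕ} (p : Fin e → ℂ) (i : Fin e) : Set ℂ := segment ℝ (p i) (p (finRotate e i))

/-- The sector of the geodesics which enter the polygon through the `i`-th edge and exit it through
the `j`-th edge. -/
def sector {e : ℕ} (p : Fin e → ℂ) (i j : Fin e) : Set (ℝ × ℝ) :=
  {γ | γ ∈ kinematicSpace ∧
    (∃ s, IsLeast (times (region p) γ) s ∧ geodesic γ s ∈ edge p i) ∧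
    (∃ t, IsGreatest (times (region p) γ) t ∧ geodesic γ t ∈ edge p j)}

/-- The integrand `λ_Q ω` as a function of the coordinates `(θ, α)`. -/
def weightedChord (L G ε : ℝ) {e : ℕ} (p : Fin e → ℂ) (γ : ℝ × ℝ) : ℝ :=
  chord L (region p) γ * croftonDensity L G ε γ

/-- The sector integral `(2 * G / π) ∫_{s_ij} λ_Q ω`. -/
def sectorIntegral (L G ε : ℝ) {e : ℕ} (p : Fin e → ℂ) (i j : Fin e) : ℝ :=
  2 * G / Real.pi * ∫ γ in sector p i j, weightedChord L G ε p γ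

end

end KinematicSpace

/-!
In the projective model the geodesic `(θ, α)` is the chord of the disk on which the inner product
with `exp (θ * I)` is `cos α`. For a fixed `θ` these chords foliate the disk, so that the integral
over `α` of the integral along the chord is, after the change of variables `(α, t) ↦ x`, an
integral over the disk. The integral of its Jacobian over `θ` is a constant multiple of the
hyperbolic area density at `x`. Hence the integral of the length of `γ ∩ Q` against the Crofton
form is `π / (2 * G)` times the area of `Q`. A geodesic is in two sectors only if it passes through
a vertex, which is a null condition, and reversing the orientation swaps the entry edge and the
exit edge.

The area of a polygon is computed from its angles by cutting it into triangles. If the point `x`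
moves from `b` to `c` along an edge of the triangle `a`, `b`, `c`, then the angle at `x` between
the directions of `c` and `a`, minus the angle at `a` between those of `b` and `x`, has as its
derivative the area of the infinitesimal triangle which the segment from `a` to `x` sweeps out.
-/

namespace KinematicSpace

open Complex MeasureTheory Set

noncomputable section

attribute [local instance] Complex.finrank_real_complex_fact

local notation "cross" => Orientation.areaForm Complex.orientation

open scoped RealInnerProductSpace

lemma cross_apply (u v : ℂ) : cross u v = u.re * v.im - u.im * v.re := by
  rw [Complex.areaForm, mul_im, conj_re, conj_im]
  ring

/-- The orientation of the triangle `a`, `b`, `x`, as an affine function of `x`: twice the signed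
area of the triangle, positive when `x` is to the left of the line from `a` to `b`. -/
def orient (a b : ℂ) : ℂ →ᵃ[ℝ] ℝ :=
  (cross (b - a)).toAffineMap - AffineMap.const ℝ ℂ (cross (b - a) a)

lemma orient_apply (a b x : ℂ) : orient a b x = cross (b - a) (x - a) := by
  simp only [orient, AffineMap.coe_sub, Pi.sub_apply, LinearMap.coe_toAffineMap,
    AffineMap.const_apply, map_sub]

lemma orient_apply_left (a b : ℂ) : orient a b a = 0 := by simp [orient_apply]

lemma orient_apply_right (a b : ℂ) : orient a b b = 0 := by
  rw [orient_apply, Orientation.areaForm_apply_self]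

lemma orient_rotate (a b x : ℂ) : orient b x a = orient a b x := by
  simp only [orient_apply, cross_apply, sub_re, sub_im]
  ring

lemma orient_swap (a b x : ℂ) : orient b a x = -orient a b x := by
  simp only [orient_apply, cross_apply, sub_re, sub_im]
  ring

lemma orient_add_orient_add_orient (a b c x : ℂ) :
    orient a b x + orient b c x + orient c a x = orient a b c := by
  simp only [orient_apply, cross_apply, sub_re, sub_im]
  ring

lemma orient_mul_orient (o u a b c : ℂ) :
    orient o a c * orient o u b = orient o a b * orient o u c + orient o b c * orient o u a := by
  simp only [orient_apply, cross_apply, sub_re, sub_im]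
  ring

lemma continuous_orient (a b : ℂ) : Continuous (orient a b) :=
  (orient a b).continuous_of_finiteDimensional

lemma ne_of_orient_pos {a b x : ℂ} (h : 0 < orient a b x) : a ≠ b := by
  rintro rfl
  simp [orient_apply] at h

lemma exists_eq_lineMap_of_orient_eq_zero {a b x : ℂ} (hab : a ≠ b) (hx : orient a b x = 0) :
    ∃ r : ℝ, x = AffineMap.lineMap a b r := by
  have hn : b - a ≠ 0 := sub_ne_zero.2 hab.symm
  have hreal : ((x - a) / (b - a)).im = 0 := by
    rw [orient_apply, cross_apply] at hx
    rw [div_im, ← sub_div, div_eq_zero_iff]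
    left
    linarith
  refine ⟨((x - a) / (b - a)).re, ?_⟩
  have hr : (((x - a) / (b - a)).re : ℂ) = (x - a) / (b - a) :=
    Complex.ext (by simp) (by simp [hreal])
  rw [AffineMap.lineMap_apply, vsub_eq_sub, vadd_eq_add, real_smul, hr, div_mul_cancel₀ _ hn,
    sub_add_cancel]

lemma mem_convexHull_triple {a b c x : ℂ} (h : 0 < orient a b c) (hab : 0 ≤ orient a b x)
    (hbc : 0 ≤ orient b c x) (hca : 0 ≤ orient c a x) : x ∈ convexHull ℝ {a, b, c} := by
  have hsum := orient_add_orient_add_orient a b c x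
  refine mem_convexHull_of_exists_fintype
    ![orient b c x / orient a b c, orient c a x / orient a b c, orient a b x / orient a b c]
    ![a, b, c] ?_ ?_ ?_ ?_
  · intro i
    fin_cases i
    exacts [div_nonneg hbc h.le, div_nonneg hca h.le, div_nonneg hab h.le]
  · simp only [Fin.sum_univ_three, Matrix.cons_val_zero, Matrix.cons_val_one, Matrix.cons_val]
    rw [← add_div, ← add_div, div_eq_one_iff_eq h.ne']
    linarith
  · intro i
    fin_cases i <;> simp
  · simp only [Fin.sum_univ_three, Matrix.cons_val_zero, Matrix.cons_val_one, Matrix.cons_val]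
    apply Complex.ext <;>
      · simp only [add_re, add_im, real_smul, re_ofReal_mul, im_ofReal_mul]
        field_simp
        simp only [orient_apply, cross_apply, sub_re, sub_im]
        ring

lemma orient_pos_of_consecutive {m : ℕ} {P : ℕ → ℂ}
    (hP : ∀ i < m, ∀ j ≤ m, j ≠ i → j ≠ i + 1 → 0 < orient (P i) (P (i + 1)) (P j))
    {i j k : ℕ} (hij : i < j) (hjk : j < k) (hk : k ≤ m) : 0 < orient (P i) (P j) (P k) := by
  have hconsecutive (l : ℕ) (hl : i < l) (hlm : l < m) : 0 < orient (P i) (P l) (P (l + 1)) := by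
    rw [← orient_rotate]
    exact hP l hlm i (by lia) (by lia) (by lia)
  have hfirst (l : ℕ) (hl : i + 1 < l) (hlm : l ≤ m) : 0 < orient (P i) (P (i + 1)) (P l) :=
    hP i (by lia) l hlm (by lia) (by lia)
  have hfirst' : 0 ≤ orient (P i) (P (i + 1)) (P j) := by
    rcases eq_or_ne j (i + 1) with rfl | hj
    · rw [orient_apply_right]
    · exact (hfirst j (by lia) (by lia)).le
  induction k, hjk using Nat.le_induction with
  | base => exact hconsecutive j hij (by lia)
  | succ k hjk ih =>
    have hfirst_k := hfirst k (by lia) (by lia)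
    have hfirst_succ := hfirst (k + 1) (by lia) hk
    have hstep := hconsecutive k (by lia) (by lia)
    have hprev := ih (by lia)
    refine pos_of_mul_pos_left ?_ hfirst_k.le
    rw [orient_mul_orient]
    positivity

lemma exists_mem_convexHull_triple {m : ℕ} (hm : 2 ≤ m) {P : ℕ → ℂ}
    (hP : ∀ i j k, i < j → j < k → k ≤ m → 0 < orient (P i) (P j) (P k)) {x : ℂ}
    (hx : ∀ i < m, 0 ≤ orient (P i) (P (i + 1)) x) (hlast : 0 ≤ orient (P m) (P 0) x) :
    ∃ i ∈ Finset.Ico 1 m, x ∈ convexHull ℝ {P 0, P i, P (i + 1)} := by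
  classical
  -- The triangle which contains `x` is the first one whose far diagonal has `x` on its right.
  have hex : ∃ i, 1 ≤ i ∧ 0 ≤ orient (P (i + 1)) (P 0) x :=
    ⟨m - 1, by lia, by rwa [Nat.sub_add_cancel (by lia)]⟩
  have hle : Nat.find hex ≤ m - 1 :=
    Nat.find_min' hex ⟨by lia, by rwa [Nat.sub_add_cancel (by lia)]⟩
  obtain ⟨hone, hright⟩ := Nat.find_spec hex
  refine ⟨Nat.find hex, Finset.mem_Ico.2 ⟨hone, by lia⟩, mem_convexHull_triple
    (hP _ _ _ (by lia) (by lia) (by lia)) ?_ (hx _ (by lia)) hright⟩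
  rcases hone.eq_or_lt with h | h
  · rw [← h]
    exact hx 0 (by lia)
  · by_contra! hneg
    refine Nat.find_min hex (m := Nat.find hex - 1) (by lia) ⟨by lia, ?_⟩
    rw [Nat.sub_add_cancel (by lia), orient_swap]
    exact neg_nonneg.2 hneg.le

section Polygon

variable {e : ℕ} {p : Fin e → ℂ}

/-- The function which is positive to the left of the line through the `i`-th edge. -/
abbrev side (p : Fin e → ℂ) (i : Fin e) : ℂ →ᵃ[ℝ] ℝ := orient (p i) (p (finRotate e i))

/-- `p` lists, in counterclockwise order, the vertices of a strictly convex polygon: the vertices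
which are not on an edge are strictly to the left of it. -/
structure IsConvexPolygon (p : Fin e → ℂ) : Prop where
  three_le : 3 ≤ e
  side_pos : ∀ i j, j ≠ i → j ≠ finRotate e i → 0 < side p i (p j)

lemma finRotate_finRotate_ne (he : 3 ≤ e) (i : Fin e) : finRotate e (finRotate e i) ≠ i := by
  have := i.neZero
  rw [finRotate_apply, finRotate_apply, add_assoc, Ne, add_eq_left, Fin.ext_iff]
  simp [Fin.val_add, Nat.mod_eq_of_lt (show 1 < e by lia), Nat.mod_eq_of_lt (show 1 + 1 < e by lia)]

lemma edge_subset_region (i : Fin e) : edge p i ⊆ region p :=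
  segment_subset_convexHull (mem_range_self _) (mem_range_self _)

lemma isCompact_region (p : Fin e → ℂ) : IsCompact (region p) :=
  (finite_range p).isCompact_convexHull ℝ

lemma side_eq_zero_of_mem_edge {i : Fin e} {x : ℂ} (hx : x ∈ edge p i) : side p i x = 0 := by
  rw [edge, segment_eq_image_lineMap] at hx
  obtain ⟨t, -, rfl⟩ := hx
  rw [AffineMap.apply_lineMap, orient_apply_left, orient_apply_right, AffineMap.lineMap_same_apply]

namespace IsConvexPolygon

lemma side_vertex_nonneg (hp : IsConvexPolygon p) (i j : Fin e) : 0 ≤ side p i (p j) := by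
  by_cases hi : j = i
  · rw [hi, orient_apply_left]
  by_cases hi' : j = finRotate e i
  · rw [hi', orient_apply_right]
  exact (hp.side_pos i j hi hi').le

lemma side_nonneg (hp : IsConvexPolygon p) (i : Fin e) {x : ℂ} (hx : x ∈ region p) :
    0 ≤ side p i x := by
  refine convexHull_min (t := side p i ⁻¹' Ici 0) ?_ ((convex_Ici 0).affine_preimage _) hx
  rintro _ ⟨j, rfl⟩
  exact hp.side_vertex_nonneg i j

lemma vertex_ne_next (hp : IsConvexPolygon p) (i : Fin e) : p i ≠ p (finRotate e i) := by
  have hne := finRotate_finRotate_ne hp.three_le i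
  exact ne_of_orient_pos (hp.side_pos i (finRotate e (finRotate e i)) hne
    fun h => hne (h.trans ((finRotate e).injective h)))

lemma mem_edge (hp : IsConvexPolygon p) {i : Fin e} {x : ℂ} (hx : x ∈ region p)
    (hi : side p i x = 0) : x ∈ edge p i := by
  obtain ⟨r, rfl⟩ := exists_eq_lineMap_of_orient_eq_zero (hp.vertex_ne_next i) hi
  have hne := finRotate_finRotate_ne hp.three_le
  obtain ⟨j, hj⟩ := (finRotate e).surjective i
  have hprev : 0 ≤ r * side p j (p (finRotate e i)) := by
    have h := hp.side_nonneg j hx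
    rwa [AffineMap.apply_lineMap, ← hj, orient_apply_right, hj, AffineMap.lineMap_apply_ring,
      mul_zero, zero_add] at h
  have hnext : 0 ≤ (1 - r) * side p (finRotate e i) (p i) := by
    have h := hp.side_nonneg (finRotate e i) hx
    rwa [AffineMap.apply_lineMap, orient_apply_left, AffineMap.lineMap_apply_ring,
      mul_zero, add_zero] at h
  have hself : i ≠ finRotate e i := fun h => hp.vertex_ne_next i (congrArg p h)
  have hprev_pos := hp.side_pos j (finRotate e i) (hj ▸ hne j) (hj ▸ hself.symm)
  have hnext_pos := hp.side_pos (finRotate e i) i hself (hne i).symm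
  rw [edge, segment_eq_image_lineMap]
  exact ⟨r, ⟨nonneg_of_mul_nonneg_left hprev hprev_pos,
    sub_nonneg.1 (nonneg_of_mul_nonneg_left hnext hnext_pos)⟩, rfl⟩

lemma mem_range_of_mem_edges (hp : IsConvexPolygon p) {i k : Fin e} (hik : i ≠ k) {x : ℂ}
    (hi : x ∈ edge p i) (hk : x ∈ edge p k) : x ∈ range p := by
  have hside := side_eq_zero_of_mem_edge hk
  rw [edge, segment_eq_image_lineMap] at hi
  obtain ⟨t, ⟨ht₀, ht₁⟩, rfl⟩ := hi
  rcases ht₀.eq_or_lt with rfl | ht₀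
  · exact ⟨i, by simp⟩
  rcases ht₁.eq_or_lt with rfl | ht₁
  · exact ⟨finRotate e i, by simp⟩
  rw [AffineMap.apply_lineMap, AffineMap.lineMap_apply_ring] at hside
  have hstart := hp.side_vertex_nonneg k i
  have hend := hp.side_vertex_nonneg k (finRotate e i)
  have hstart_zero : side p k (p i) = 0 := by nlinarith
  have hend_zero : side p k (p (finRotate e i)) = 0 := by nlinarith
  have hi_eq : i = finRotate e k := by
    by_contra h
    exact (hp.side_pos k i hik h).ne' hstart_zero
  have hnext_eq : finRotate e i = k := by
    by_contra h
    exact (hp.side_pos k _ h fun h' => hik ((finRotate e).injective h')).ne' hend_zero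
  exact absurd (by rw [← hi_eq, hnext_eq]) (finRotate_finRotate_ne hp.three_le k)

end IsConvexPolygon

/-- The vertices of a polygon as a periodic sequence. -/
def vertex [NeZero e] (p : Fin e → ℂ) (k : ℕ) : ℂ := p (Fin.ofNat e k)

lemma vertex_val [NeZero e] (p : Fin e → ℂ) (i : Fin e) : vertex p i = p i := by
  simp [vertex]

lemma vertex_val_add_one [NeZero e] (p : Fin e → ℂ) (i : Fin e) :
    vertex p (i + 1) = p (finRotate e i) := by
  rw [vertex, finRotate_apply]
  congr 1
  ext
  simp [Fin.val_add]

lemma vertex_periodic [NeZero e] (p : Fin e → ℂ) : Function.Periodic (vertex p) e := fun k => by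
  rw [vertex, vertex]
  congr 1
  ext
  simp

lemma side_eq_orient_vertex [NeZero e] (p : Fin e → ℂ) (i : Fin e) :
    side p i = orient (vertex p i) (vertex p (i + 1)) := by
  rw [vertex_val, vertex_val_add_one]

namespace IsConvexPolygon

variable [NeZero e]

lemma orient_vertex_pos (hp : IsConvexPolygon p) {i j k : ℕ} (hij : i < j) (hjk : j < k)
    (hk : k < e) : 0 < orient (vertex p i) (vertex p j) (vertex p k) := by
  refine orient_pos_of_consecutive (m := e - 1) (fun i hi j hj hji hji' => ?_) hij hjk (by lia)
  have hnext : (⟨j, by lia⟩ : Fin e) ≠ finRotate e ⟨i, by lia⟩ := by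
    rw [finRotate_apply, Ne, Fin.ext_iff, Fin.val_add, Fin.val_one', Nat.add_mod_mod,
      Nat.mod_eq_of_lt (by lia)]
    exact hji'
  have h := hp.side_pos ⟨i, by lia⟩ ⟨j, by lia⟩ (by simpa using hji) hnext
  rwa [side_eq_orient_vertex, ← vertex_val p ⟨j, _⟩] at h

lemma exists_mem_fan_triangle (hp : IsConvexPolygon p) {x : ℂ} (hx : ∀ i, 0 ≤ side p i x) :
    ∃ i ∈ Finset.Ico 1 (e - 1), x ∈ convexHull ℝ {vertex p 0, vertex p i, vertex p (i + 1)} := by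
  have he := hp.three_le
  simp only [side_eq_orient_vertex] at hx
  refine exists_mem_convexHull_triple (by lia)
    (fun i j k hij hjk hk => hp.orient_vertex_pos hij hjk (by lia))
    (fun i hi => hx ⟨i, by lia⟩) ?_
  have hlast := hx ⟨e - 1, by lia⟩
  rwa [Nat.sub_add_cancel (by lia), (vertex_periodic p).eq] at hlast

lemma fan_triangle_subset_region (p : Fin e → ℂ) (i : ℕ) :
    convexHull ℝ {vertex p 0, vertex p i, vertex p (i + 1)} ⊆ region p := by
  refine convexHull_mono ?_
  rintro x (rfl | rfl | rfl) <;> exact mem_range_self _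

lemma region_eq_biUnion_fan (hp : IsConvexPolygon p) :
    region p = ⋃ i ∈ Finset.Ico 1 (e - 1),
      convexHull ℝ {vertex p 0, vertex p i, vertex p (i + 1)} := by
  refine Subset.antisymm (fun x hx => ?_)
    (iUnion₂_subset fun i _ => fan_triangle_subset_region p i)
  obtain ⟨i, hi, hxi⟩ := hp.exists_mem_fan_triangle fun i => hp.side_nonneg i hx
  exact mem_biUnion hi hxi

lemma mem_region_of_side_nonneg (hp : IsConvexPolygon p) {x : ℂ} (hx : ∀ i, 0 ≤ side p i x) :
    x ∈ region p := by
  obtain ⟨i, -, hxi⟩ := hp.exists_mem_fan_triangle hx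
  exact fan_triangle_subset_region p i hxi

end IsConvexPolygon

end Polygon

/-- The factor `1 - ‖x‖ ^ 2` by which the metric of the projective model degenerates at the
boundary circle. -/
def gap (x : ℂ) : ℝ := 1 - ‖x‖ ^ 2

/-- The metric of radius one in the tangent space at `x`, without its denominator `gap x ^ 2`. -/
def gram (x u v : ℂ) : ℝ := gap x * ⟪u, v⟫ + ⟪x, u⟫ * ⟪x, v⟫

/-- The area density of the metric of radius one. -/
def density (x : ℂ) : ℝ := 1 / (gap x * √(gap x))

lemma inner_apply (u v : ℂ) : ⟪u, v⟫ = u.re * v.re + u.im * v.im := by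
  rw [Complex.inner, mul_re, conj_re, conj_im]
  ring

lemma gap_apply (x : ℂ) : gap x = 1 - (x.re * x.re + x.im * x.im) := by
  rw [gap, Complex.sq_norm, normSq_apply]

lemma gap_pos {x : ℂ} (hx : x ∈ Metric.ball 0 1) : 0 < gap x := by
  rw [mem_ball_zero_iff] at hx
  rw [gap, sub_pos, sq_lt_one_iff₀ (norm_nonneg x)]
  exact hx

lemma continuous_gap : Continuous gap := by
  unfold gap
  fun_prop

lemma gram_self_pos {x u : ℂ} (hx : 0 < gap x) (hu : u ≠ 0) : 0 < gram x u u := by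
  rw [gram, real_inner_self_eq_norm_sq]
  have := norm_pos_iff.2 hu
  nlinarith [mul_self_nonneg ⟪x, u⟫, mul_pos hx (sq_pos_of_pos this)]

lemma gram_self_mul_gram_self (x u v : ℂ) :
    gram x u u * gram x v v = gram x u v ^ 2 + gap x * cross u v ^ 2 := by
  simp only [gram, gap_apply, inner_apply, cross_apply]
  ring

lemma metric_eq_gram_div (L : ℝ) {x : ℂ} (hx : gap x ≠ 0) (u v : ℂ) :
    metric L x u v = L ^ 2 * (gram x u v / gap x ^ 2) := by
  rw [metric, gram, ← gap]
  field_simp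

lemma density_nonneg {x : ℂ} (hx : x ∈ Metric.ball 0 1) : 0 ≤ density x := by
  have := gap_pos hx
  unfold density
  positivity

lemma measurable_density : Measurable density := by
  unfold density
  exact measurable_const.div (continuous_gap.mul continuous_gap.sqrt).measurable

lemma continuousOn_density : ContinuousOn density (Metric.ball 0 1) := by
  refine continuousOn_const.div (continuous_gap.mul continuous_gap.sqrt).continuousOn fun x hx => ?_
  have := gap_pos hx
  positivity

lemma sqrt_det_metric (L : ℝ) {x : ℂ} (hx : x ∈ Metric.ball 0 1) :
    √(metric L x 1 1 * metric L x I I - metric L x 1 I ^ 2) = L ^ 2 * density x := by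
  have hgap := gap_pos hx
  have hdet : metric L x 1 1 * metric L x I I - metric L x 1 I ^ 2
      = (L ^ 2 / gap x) ^ 2 / gap x := by
    have hgram := gram_self_mul_gram_self x 1 I
    rw [show cross 1 I = 1 by simp] at hgram
    simp only [metric_eq_gram_div L hgap.ne']
    field_simp
    linear_combination L ^ 4 * hgram
  rw [hdet, Real.sqrt_div (by positivity), Real.sqrt_sq (by positivity), density]
  field_simp

lemma area_eq_integral_density (L : ℝ) {Q : Set ℂ} (hQ : MeasurableSet Q)
    (hsub : Q ⊆ Metric.ball 0 1) : area L Q = L ^ 2 * ∫ x in Q, density x := by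
  rw [area, ← integral_const_mul]
  exact setIntegral_congr_fun hQ fun x hx => sqrt_det_metric L (hsub hx)

/-- A complex number whose argument is the oriented angle from `u` to `v` in the tangent space
at `x`. -/
def angleForm (x u v : ℂ) : ℂ := ⟨gram x u v, √(gap x) * cross u v⟩

/-- The oriented angle from `u` to `v` in the tangent space at `x`. -/
def hypAngle (x u v : ℂ) : ℝ := (angleForm x u v).arg

section Angle

variable {x u v w : ℂ}

lemma angleForm_im_pos (hx : 0 < gap x) (huv : 0 < cross u v) : 0 < (angleForm x u v).im :=
  mul_pos (Real.sqrt_pos.2 hx) huv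

lemma hypAngle_mem_Ico (hx : 0 < gap x) (huv : 0 < cross u v) : hypAngle x u v ∈ Ico 0 Real.pi :=
  have him := angleForm_im_pos hx huv
  ⟨arg_nonneg_iff.2 him.le, arg_lt_pi_iff.2 (Or.inr him.ne')⟩

lemma angleForm_mul_angleForm (hx : 0 ≤ gap x) (u v w : ℂ) :
    angleForm x u v * angleForm x v w = (gram x v v : ℂ) * angleForm x u w := by
  have hsqrt := Real.sq_sqrt hx
  apply Complex.ext
  · rw [re_ofReal_mul]
    have hgram : gram x u v * gram x v w - gap x * (cross u v * cross v w)
        = gram x v v * gram x u w := by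
      simp only [gram, gap_apply, inner_apply, cross_apply]
      ring
    simp only [angleForm, mul_re]
    linear_combination hgram - cross u v * cross v w * hsqrt
  · rw [im_ofReal_mul]
    simp only [angleForm, mul_im, gram, inner_apply, cross_apply]
    ring

lemma hypAngle_add_hypAngle (hx : 0 < gap x) (huv : 0 < cross u v) (hvw : 0 < cross v w)
    (huw : 0 < cross u w) : hypAngle x u v + hypAngle x v w = hypAngle x u w := by
  have hne {a b : ℂ} (h : 0 < cross a b) : angleForm x a b ≠ 0 := fun h₀ =>
    (angleForm_im_pos hx h).ne' (by rw [h₀, zero_im])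
  have hv : v ≠ 0 := by
    rintro rfl
    simp at huv
  have hcoe := arg_mul_coe_angle (hne huv) (hne hvw)
  rw [angleForm_mul_angleForm hx.le, arg_real_mul _ (gram_self_pos hx hv), ← Real.Angle.coe_add,
    Real.Angle.angle_eq_iff_two_pi_dvd_sub] at hcoe
  obtain ⟨k, hk⟩ := hcoe
  change hypAngle x u w - (hypAngle x u v + hypAngle x v w) = 2 * Real.pi * k at hk
  obtain ⟨huv₀, huv₁⟩ := hypAngle_mem_Ico hx huv
  obtain ⟨hvw₀, hvw₁⟩ := hypAngle_mem_Ico hx hvw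
  obtain ⟨huw₀, huw₁⟩ := hypAngle_mem_Ico hx huw
  have hk_gt : (-1 : ℝ) < k := by nlinarith
  have hk_lt : (k : ℝ) < 1 := by nlinarith
  have hk₀ : k = 0 := by
    have : -1 < k := by exact_mod_cast hk_gt
    have : k < 1 := by exact_mod_cast hk_lt
    lia
  rw [hk₀, Int.cast_zero, mul_zero] at hk
  linarith

lemma hypAngle_neg_right (hx : 0 < gap x) (huv : 0 < cross u v) :
    hypAngle x v (-u) = Real.pi - hypAngle x u v := by
  have hconj : angleForm x v (-u) = -(starRingEnd ℂ) (angleForm x u v) := by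
    apply Complex.ext <;>
      · simp only [angleForm, gram, inner_apply, cross_apply, neg_re, neg_im, conj_re, conj_im]
        ring
  have him := angleForm_im_pos hx huv
  rw [hypAngle, hconj, arg_neg_eq_arg_add_pi_of_im_neg (by simpa using him), arg_conj, if_neg
    (arg_lt_pi_iff.2 (Or.inr him.ne')).ne, hypAngle]
  ring

lemma hypAngle_neg_neg (x u v : ℂ) : hypAngle x (-u) (-v) = hypAngle x u v := by
  simp only [hypAngle, angleForm, gram, inner_neg_left, inner_neg_right, neg_mul_neg, map_neg,
    LinearMap.neg_apply, neg_neg]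

lemma hypAngle_eq_pi_div_two (hx : 0 < gap x) (huv : 0 < cross u v) (h : gram x u v = 0) :
    hypAngle x u v = Real.pi / 2 :=
  arg_eq_pi_div_two_iff.2 ⟨h, angleForm_im_pos hx huv⟩

end Angle

lemma hasDerivAt_arg_mk {f g : ℝ → ℝ} {f' g' t : ℝ} (hf : HasDerivAt f f' t)
    (hg : HasDerivAt g g' t) (ht : 0 < g t) :
    HasDerivAt (fun s => arg ⟨f s, g s⟩) ((f t * g' - g t * f') / (f t ^ 2 + g t ^ 2)) t := by
  have hz : HasDerivAt (fun s => (f s : ℂ) + g s * I) (f' + g' * I) t :=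
    hf.ofReal_comp.add (hg.ofReal_comp.mul_const I)
  have hlog := hz.clog_real (Or.inr (by simpa using ht.ne'))
  have him := imCLM.hasFDerivAt.comp_hasDerivAt t hlog
  simp only [Function.comp_def, imCLM_apply, log_im, ← mk_eq_add_mul_I] at him
  refine him.congr_deriv ?_
  rw [div_im, normSq_mk, ← sub_div]
  ring

section MovingPoint

variable {X : ℝ → ℂ} {a d : ℂ} {t : ℝ}

lemma hasDerivAt_gap (hX : HasDerivAt X d t) :
    HasDerivAt (fun s => gap (X s)) (-(2 * ⟪X t, d⟫)) t :=
  hX.norm_sq.const_sub 1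

lemma hasDerivAt_sqrt_gap (hX : HasDerivAt X d t) (h : 0 < gap (X t)) :
    HasDerivAt (fun s => √(gap (X s))) (-⟪X t, d⟫ / √(gap (X t))) t := by
  refine ((hasDerivAt_gap hX).sqrt h.ne').congr_deriv ?_
  field_simp

lemma hasDerivAt_inner_const (hX : HasDerivAt X d t) (a : ℂ) :
    HasDerivAt (fun s => ⟪a, X s⟫) ⟪a, d⟫ t := by
  simpa using (hasDerivAt_const t a).inner ℝ hX

lemma hasDerivAt_cross_sub (hX : HasDerivAt X d t) (a u : ℂ) :
    HasDerivAt (fun s => cross (X s - a) u) (cross d u) t :=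
  (LinearMap.toContinuousLinearMap ((cross).flip u)).hasFDerivAt.comp_hasDerivAt t (hX.sub_const a)

lemma hasDerivAt_hypAngle_fixedVertex (hX : HasDerivAt X d t) (ha : 0 < gap a)
    (hturn : 0 < cross (X t - a) d) :
    HasDerivAt (fun s => hypAngle a (X s - a) d)
      (-(√(gap a) * cross (X t - a) d / gram a (X t - a) (X t - a))) t := by
  have hgram : HasDerivAt (fun s => gram a (X s - a) d) (gram a d d) t := by
    refine ((((hX.sub_const a).inner ℝ (hasDerivAt_const t d)).const_mul (gap a)).add
      ((hasDerivAt_inner_const (hX.sub_const a) a).mul_const ⟪a, d⟫)).congr_deriv ?_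
    rw [inner_zero_right, zero_add, gram]
  have hcross := (hasDerivAt_cross_sub hX a d).const_mul (√(gap a))
  have hd : d ≠ 0 := by
    rintro rfl
    simp at hturn
  have hXa : X t - a ≠ 0 := fun h => by simp [h] at hturn
  have := gram_self_pos ha hd
  have := gram_self_pos ha hXa
  refine (hasDerivAt_arg_mk hgram hcross (mul_pos (Real.sqrt_pos.2 ha) hturn)).congr_deriv ?_
  rw [mul_pow, Real.sq_sqrt ha.le, ← gram_self_mul_gram_self, Orientation.areaForm_apply_self]
  field_simp
  ring

lemma hasDerivAt_gram_movingVertex (hX : HasDerivAt X d t) (a : ℂ) :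
    HasDerivAt (fun s => gram (X s) d (a - X s))
      (-(⟪X t, d⟫ * ⟪a, d⟫ + (1 - ⟪a, X t⟫) * ⟪d, d⟫)) t := by
  have hd := hasDerivAt_const t d
  refine (((hasDerivAt_gap hX).mul (hd.inner ℝ (hX.const_sub a))).add
    ((hX.inner ℝ hd).mul (hX.inner ℝ (hX.const_sub a)))).congr_deriv ?_
  simp only [gap_apply, inner_apply, sub_re, sub_im, neg_re, neg_im, zero_re, zero_im]
  ring

/-- The common value of the two sides is `(1 - ⟪a, x⟫) ^ 2 - gap a * gap x`. -/
lemma gram_sub_symm (a x : ℂ) : gram a (x - a) (x - a) = gram x (a - x) (a - x) := by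
  simp only [gram, gap_apply, inner_apply, sub_re, sub_im]
  ring

lemma hasDerivAt_hypAngle_movingVertex (hX : HasDerivAt X d t) (hgap : 0 < gap (X t))
    (hturn : 0 < cross (X t - a) d) :
    HasDerivAt (fun s => hypAngle (X s) d (a - X s))
      ((1 - ⟪a, X t⟫) * cross (X t - a) d / (√(gap (X t)) * gram a (X t - a) (X t - a))) t := by
  have hcross_eq (s : ℝ) : cross d (a - X s) = cross (X s - a) d := by
    rw [← neg_sub (X s) a, map_neg, ← Orientation.areaForm_swap]
  have hcross := (hasDerivAt_sqrt_gap hX hgap).mul (hasDerivAt_cross_sub hX a d)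
  have hpos := Real.sqrt_pos.2 hgap
  have hsq := Real.sq_sqrt hgap.le
  have hd : d ≠ 0 := by
    rintro rfl
    simp at hturn
  have hXa : a - X t ≠ 0 := fun h => by
    rw [← hcross_eq, h, map_zero] at hturn
    exact hturn.false
  have hdd := gram_self_pos hgap hd
  have hvv := gram_self_pos hgap hXa
  have hprod := gram_self_mul_gram_self (X t) d (a - X t)
  rw [hcross_eq] at hprod
  rw [← gram_sub_symm] at hvv hprod
  have hnum : gram (X t) d (a - X t) * -⟪X t, d⟫
      + gap (X t) * (⟪X t, d⟫ * ⟪a, d⟫ + (1 - ⟪a, X t⟫) * ⟪d, d⟫)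
      = (1 - ⟪a, X t⟫) * gram (X t) d d := by
    simp only [gram, gap_apply, inner_apply, sub_re, sub_im]
    ring
  simp only [hypAngle, angleForm, hcross_eq]
  refine (hasDerivAt_arg_mk (hasDerivAt_gram_movingVertex hX a) hcross
    (mul_pos hpos hturn)).congr_deriv ?_
  rw [Pi.mul_apply, mul_pow, hsq, ← hprod, Orientation.areaForm_apply_self]
  field_simp
  rw [hsq]
  linear_combination cross (X t - a) d * hnum

lemma hasDerivAt_one_sub_inner_div_sqrt_gap (a x : ℂ) (ht : 0 < gap (AffineMap.lineMap a x t)) :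
    HasDerivAt (fun s : ℝ => (1 - ⟪a, AffineMap.lineMap a x s⟫) / √(gap (AffineMap.lineMap a x s)))
      (t * density (AffineMap.lineMap a x t) * gram a (x - a) (x - a)) t := by
  have hY := AffineMap.hasDerivAt_lineMap (a := a) (b := x) (x := t)
  have hpos := Real.sqrt_pos.2 ht
  refine (((hasDerivAt_inner_const hY a).const_sub 1).div (hasDerivAt_sqrt_gap hY ht)
    hpos.ne').congr_deriv ?_
  have hsq := Real.sq_sqrt ht.le
  have hx : AffineMap.lineMap a x t = a + t • (x - a) := by
    rw [AffineMap.lineMap_apply, vsub_eq_sub, vadd_eq_add, add_comm]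
  have halg : (1 - ⟪a, AffineMap.lineMap a x t⟫) * ⟪AffineMap.lineMap a x t, x - a⟫
      - ⟪a, x - a⟫ * gap (AffineMap.lineMap a x t) = t * gram a (x - a) (x - a) := by
    rw [hx]
    simp only [gram, gap_apply, inner_apply, sub_re, sub_im, add_re, add_im, real_smul,
      re_ofReal_mul, im_ofReal_mul]
    ring
  rw [density]
  field_simp
  rw [hsq]
  linear_combination gap (AffineMap.lineMap a x t) * halg

end MovingPoint

section ChangeOfVariables

variable {S : Set (ℝ × ℝ)} {F u v : ℝ × ℝ → ℂ}

/-- The linear map with the partial derivatives `u` and `v`. -/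
def ofPartials (u v : ℂ) : ℝ × ℝ →L[ℝ] ℂ :=
  (ContinuousLinearMap.fst ℝ ℝ ℝ).smulRight u + (ContinuousLinearMap.snd ℝ ℝ ℝ).smulRight v

lemma det_ofPartials (u v : ℂ) :
    ((ofPartials u v).comp (equivRealProdCLM : ℂ →L[ℝ] ℝ × ℝ)).det = cross u v := by
  have hone : (ofPartials u v).comp (equivRealProdCLM : ℂ →L[ℝ] ℝ × ℝ) 1 = u := by
    simp [ofPartials]
  have hI : (ofPartials u v).comp (equivRealProdCLM : ℂ →L[ℝ] ℝ × ℝ) I = v := by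
    simp [ofPartials]
  rw [ContinuousLinearMap.det, ← LinearMap.det_toMatrix basisOneI, Matrix.det_fin_two, cross_apply]
  simp only [LinearMap.toMatrix_apply, coe_basisOneI, coe_basisOneI_repr, Matrix.cons_val_zero,
    Matrix.cons_val_one, ContinuousLinearMap.coe_coe, hone, hI]
  ring

lemma image_comp_equivRealProd (F : ℝ × ℝ → ℂ) (S : Set (ℝ × ℝ)) :
    (F ∘ measurableEquivRealProd) '' (measurableEquivRealProd ⁻¹' S) = F '' S := by
  rw [image_comp, image_preimage_eq S measurableEquivRealProd.surjective]

lemma lintegral_image_eq_lintegral_cross_mul (hS : MeasurableSet S)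
    (hF : ∀ z ∈ S, HasFDerivAt F (ofPartials (u z) (v z)) z) (hinj : InjOn F S)
    (f : ℂ → ENNReal) :
    ∫⁻ x in F '' S, f x = ∫⁻ z in S, ENNReal.ofReal |cross (u z) (v z)| * f (F z) := by
  rw [← volume_preserving_equiv_real_prod.setLIntegral_comp_preimage_emb
    measurableEquivRealProd.measurableEmbedding, ← image_comp_equivRealProd,
    lintegral_image_eq_lintegral_abs_det_fderiv_mul volume (measurableEquivRealProd.measurable hS)
      (fun w hw => ((hF _ hw).comp w equivRealProdCLM.hasFDerivAt).hasFDerivWithinAt)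
      (hinj.comp equivRealProdCLM.injective.injOn fun w hw => hw)]
  simp only [det_ofPartials]
  rfl

lemma integral_image_eq_integral_cross_mul (hS : MeasurableSet S)
    (hF : ∀ z ∈ S, HasFDerivAt F (ofPartials (u z) (v z)) z) (hinj : InjOn F S) (f : ℂ → ℝ) :
    ∫ x in F '' S, f x = ∫ z in S, |cross (u z) (v z)| * f (F z) := by
  rw [← volume_preserving_equiv_real_prod.setIntegral_preimage_emb
    measurableEquivRealProd.measurableEmbedding, ← image_comp_equivRealProd,
    integral_image_eq_integral_abs_det_fderiv_smul volume (measurableEquivRealProd.measurable hS)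
      (fun w hw => ((hF _ hw).comp w equivRealProdCLM.hasFDerivAt).hasFDerivWithinAt)
      (hinj.comp equivRealProdCLM.injective.injOn fun w hw => hw)]
  simp only [det_ofPartials]
  rfl

end ChangeOfVariables

section Triangle

variable {a b c : ℂ}

/-- Parametrization of the triangle with apex `a` by the position `z.1` on the opposite edge and
the relative distance `z.2` from the apex. -/
def triangleMap (a b c : ℂ) (z : ℝ × ℝ) : ℂ :=
  AffineMap.lineMap a (AffineMap.lineMap b c z.1 : ℂ) z.2

lemma convexHull_triple_eq_image (a b c : ℂ) :
    convexHull ℝ {a, b, c} = triangleMap a b c '' (Icc 0 1 ×ˢ Icc 0 1) := by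
  rw [convexHull_insert (by simp), convexHull_pair, convexJoin_singleton_left]
  ext x
  simp only [segment_eq_image_lineMap, mem_iUnion, mem_image, exists_prop, exists_exists_and_eq_and,
    mem_prod, Prod.exists, triangleMap, and_assoc, exists_and_left]

lemma continuous_triangleMap (a b c : ℂ) : Continuous (triangleMap a b c) := by
  have h : triangleMap a b c = fun z => z.2 • (z.1 • (c - b) + b - a) + a := by
    funext z
    rw [triangleMap, AffineMap.lineMap_apply_module', AffineMap.lineMap_apply_module']
  rw [h]
  fun_prop

lemma cross_lineMap_sub (a b c : ℂ) (τ : ℝ) :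
    cross (AffineMap.lineMap b c τ - a) (c - b) = orient a b c := by
  simp only [AffineMap.lineMap_apply_module', orient_apply, cross_apply, sub_re, sub_im, add_re,
    add_im, real_smul, re_ofReal_mul, im_ofReal_mul]
  ring

lemma hasFDerivAt_triangleMap (a b c : ℂ) (z : ℝ × ℝ) :
    HasFDerivAt (triangleMap a b c)
      (ofPartials (z.2 • (c - b)) (AffineMap.lineMap b c z.1 - a)) z := by
  have h := (hasFDerivAt_snd (𝕜 := ℝ) (p := z)).smul
    (((hasFDerivAt_fst (𝕜 := ℝ) (p := z)).smul_const (c - b)).add_const (b - a))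
  have heq : triangleMap a b c = fun z => z.2 • (z.1 • (c - b) + (b - a)) + a := by
    funext z
    rw [triangleMap, AffineMap.lineMap_apply_module', AffineMap.lineMap_apply_module',
      add_sub_assoc]
  rw [heq]
  refine (h.add_const a).congr_fderiv ?_
  rw [AffineMap.lineMap_apply_module', add_sub_assoc]
  ext <;> simp [ofPartials]

lemma injOn_triangleMap (h : orient a b c ≠ 0) : InjOn (triangleMap a b c) (univ ×ˢ Ioi 0) := by
  have hfar (z : ℝ × ℝ) : orient b c (triangleMap a b c z) = (1 - z.2) * orient a b c := by
    rw [triangleMap, AffineMap.apply_lineMap, AffineMap.apply_lineMap, orient_apply_left,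
      orient_apply_right, AffineMap.lineMap_same_apply, AffineMap.lineMap_apply_ring, mul_zero,
      add_zero, orient_rotate]
  have hnear (z : ℝ × ℝ) : orient a b (triangleMap a b c z) = z.2 * (z.1 * orient a b c) := by
    rw [triangleMap, AffineMap.apply_lineMap, AffineMap.apply_lineMap, orient_apply_left,
      orient_apply_right, AffineMap.lineMap_apply_ring, AffineMap.lineMap_apply_ring, mul_zero,
      zero_add, mul_zero, zero_add]
  intro z hz z' _ heq
  have hsnd : z.2 = z'.2 := by
    have := (hfar z).symm.trans ((congrArg _ heq).trans (hfar z'))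
    linarith [mul_right_cancel₀ h this]
  have := (hnear z).symm.trans ((congrArg _ heq).trans (hnear z'))
  rw [← hsnd] at this
  exact Prod.ext (mul_right_cancel₀ h (mul_left_cancel₀ (ne_of_gt hz.2) this)) hsnd

lemma convexHull_triple_ae_eq_image (a b c : ℂ) :
    convexHull ℝ {a, b, c} =ᵐ[volume] triangleMap a b c '' (Icc 0 1 ×ˢ Ioc 0 1) := by
  rw [convexHull_triple_eq_image]
  have hsub := image_mono (f := triangleMap a b c)
    (prod_mono (Subset.refl (Icc (0 : ℝ) 1)) (Ioc_subset_Icc_self (a := (0 : ℝ)) (b := 1)))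
  refine (hsub.eventuallyLE.antisymm (ae_le_set.2 (measure_mono_null ?_
    (measure_singleton a)))).symm
  rintro _ ⟨⟨⟨τ, s⟩, ⟨hτ, hs⟩, rfl⟩, hx⟩
  rcases hs.1.eq_or_lt with rfl | hs₀
  · exact AffineMap.lineMap_apply_zero _ _
  · exact absurd ⟨(τ, s), ⟨hτ, hs₀, hs.2⟩, rfl⟩ hx

lemma integral_triangle (h : 0 < orient a b c) {f : ℂ → ℝ}
    (hf : ContinuousOn f (convexHull ℝ {a, b, c})) :
    ∫ x in convexHull ℝ {a, b, c}, f x =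
      ∫ τ in (0 : ℝ)..1, orient a b c * ∫ s in (0 : ℝ)..1, s * f (triangleMap a b c (τ, s)) := by
  have hS : MeasurableSet (Icc (0 : ℝ) 1 ×ˢ Ioc (0 : ℝ) 1) :=
    measurableSet_Icc.prod measurableSet_Ioc
  have hjac : ∀ z ∈ Icc (0 : ℝ) 1 ×ˢ Ioc (0 : ℝ) 1,
      |cross (z.2 • (c - b)) (AffineMap.lineMap b c z.1 - a)| = orient a b c * z.2 := by
    rintro z ⟨-, hz⟩
    rw [map_smul, LinearMap.smul_apply, Orientation.areaForm_swap, cross_lineMap_sub, smul_eq_mul,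
      mul_neg, abs_neg, abs_of_pos (mul_pos hz.1 h), mul_comm]
  have hint : IntegrableOn (fun z : ℝ × ℝ => orient a b c * (z.2 * f (triangleMap a b c z)))
      (Icc 0 1 ×ˢ Ioc 0 1) := by
    refine (ContinuousOn.integrableOn_compact (isCompact_Icc.prod isCompact_Icc)
      (.mul continuousOn_const (.mul (by fun_prop)
        (hf.comp (continuous_triangleMap a b c).continuousOn ?_)))).mono_set
      (prod_mono subset_rfl Ioc_subset_Icc_self)
    rw [convexHull_triple_eq_image]
    exact mapsTo_image _ _
  rw [setIntegral_congr_set (convexHull_triple_ae_eq_image a b c),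
    integral_image_eq_integral_cross_mul hS (fun z _ => hasFDerivAt_triangleMap a b c z)
    ((injOn_triangleMap h.ne').mono (prod_mono (subset_univ _) Ioc_subset_Ioi_self)),
    setIntegral_congr_fun hS fun z hz => by rw [hjac z hz, mul_assoc], Measure.volume_eq_prod,
    setIntegral_prod _ hint, integral_Icc_eq_integral_Ioc]
  simp only [intervalIntegral.integral_of_le zero_le_one, integral_const_mul]

lemma integral_density_segment {x : ℂ} (ha : a ∈ Metric.ball 0 1) (hx : x ∈ Metric.ball 0 1)
    (hax : x ≠ a) :
    ∫ s in (0 : ℝ)..1, s * density (AffineMap.lineMap a x s) =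
      ((1 - ⟪a, x⟫) / √(gap x) - √(gap a)) / gram a (x - a) (x - a) := by
  have hseg : ∀ s ∈ uIcc (0 : ℝ) 1, AffineMap.lineMap a x s ∈ Metric.ball (0 : ℂ) 1 := by
    intro s hs
    rw [uIcc_of_le zero_le_one] at hs
    exact (convex_ball 0 1).lineMap_mem ha hx hs
  have hcont : ContinuousOn (fun s : ℝ => s * density (AffineMap.lineMap a x s)) (uIcc 0 1) :=
    continuousOn_id.mul (continuousOn_density.comp AffineMap.lineMap_continuous.continuousOn hseg)
  have hgram := gram_self_pos (gap_pos ha) (sub_ne_zero.2 hax)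
  have hgap : 1 - ⟪a, a⟫ = √(gap a) * √(gap a) := by
    rw [Real.mul_self_sqrt (gap_pos ha).le, real_inner_self_eq_norm_sq, gap]
  have hFTC := intervalIntegral.integral_eq_sub_of_hasDerivAt
    (fun s hs => hasDerivAt_one_sub_inner_div_sqrt_gap a x (gap_pos (hseg s hs)))
    (hcont.mul continuousOn_const).intervalIntegrable
  rw [intervalIntegral.integral_mul_const, AffineMap.lineMap_apply_one,
    AffineMap.lineMap_apply_zero, hgap, mul_self_div_self] at hFTC
  rw [eq_div_iff hgram.ne', hFTC]

lemma hasDerivAt_hypAngle_add_hypAngle (ha : a ∈ Metric.ball 0 1) (h : 0 < orient a b c) {τ : ℝ}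
    (hτ : AffineMap.lineMap b c τ ∈ Metric.ball (0 : ℂ) 1) :
    HasDerivAt (fun t : ℝ =>
        hypAngle (AffineMap.lineMap b c t) (c - b) (a - AffineMap.lineMap b c t)
        + hypAngle a (AffineMap.lineMap b c t - a) (c - b))
      (orient a b c * ∫ s in (0 : ℝ)..1, s * density (triangleMap a b c (τ, s))) τ := by
  have hX := AffineMap.hasDerivAt_lineMap (a := b) (b := c) (x := τ)
  have hgap := gap_pos hτ
  have hne : AffineMap.lineMap b c τ ≠ a := by
    intro h₀
    have := cross_lineMap_sub a b c τ
    rw [h₀, sub_self, map_zero, LinearMap.zero_apply] at this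
    exact h.ne this
  have hturn : 0 < cross (AffineMap.lineMap b c τ - a) (c - b) := by rwa [cross_lineMap_sub]
  refine ((hasDerivAt_hypAngle_movingVertex hX hgap hturn).add
    (hasDerivAt_hypAngle_fixedVertex hX (gap_pos ha) hturn)).congr_deriv ?_
  simp only [triangleMap, integral_density_segment ha hτ hne, cross_lineMap_sub]
  have := gram_self_pos (gap_pos ha) (sub_ne_zero.2 hne)
  have := Real.sqrt_pos.2 hgap
  field_simp
  ring

/-- The interior angle at `b` of a polygon in which `a`, `b`, `c` are consecutive vertices in
counterclockwise order. -/
def vertexAngle (a b c : ℂ) : ℝ := hypAngle b (c - b) (a - b)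

lemma vertexAngle_add_vertexAngle {d : ℂ} (hb : b ∈ Metric.ball 0 1) (hca : 0 < orient b c a)
    (hdc : 0 < orient b d c) (hda : 0 < orient b d a) :
    vertexAngle a b c + vertexAngle c b d = vertexAngle a b d := by
  rw [orient_apply] at hca hdc hda
  rw [add_comm]
  exact hypAngle_add_hypAngle (gap_pos hb) hdc hca hda

lemma integral_density_triangle (ha : a ∈ Metric.ball 0 1) (hb : b ∈ Metric.ball 0 1)
    (hc : c ∈ Metric.ball 0 1) (h : 0 < orient a b c) :
    ∫ x in convexHull ℝ {a, b, c}, density x =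
      Real.pi - (vertexAngle c a b + vertexAngle a b c + vertexAngle b c a) := by
  have hedge {τ : ℝ} (hτ : τ ∈ Icc 0 1) : AffineMap.lineMap b c τ ∈ Metric.ball (0 : ℂ) 1 :=
    (convex_ball 0 1).lineMap_mem hb hc hτ
  have htriangle {τ s : ℝ} (hτ : τ ∈ Icc 0 1) (hs : s ∈ Icc 0 1) :
      triangleMap a b c (τ, s) ∈ Metric.ball 0 1 := (convex_ball 0 1).lineMap_mem ha (hedge hτ) hs
  have hsub : convexHull ℝ {a, b, c} ⊆ Metric.ball 0 1 := by
    rw [convexHull_triple_eq_image]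
    rintro _ ⟨z, hz, rfl⟩
    exact htriangle hz.1 hz.2
  have hderiv (τ : ℝ) (hτ : τ ∈ Icc 0 1) := hasDerivAt_hypAngle_add_hypAngle ha h (hedge hτ)
  have hint := intervalIntegral.intervalIntegrable_deriv_of_nonneg (a := 0) (b := 1)
    (fun τ hτ => (hderiv τ (by rwa [uIcc_of_le zero_le_one] at hτ)).continuousAt.continuousWithinAt)
    (fun τ hτ => hderiv τ (Ioo_subset_Icc_self (by simpa using hτ))) fun τ hτ =>
      mul_nonneg h.le <| intervalIntegral.integral_nonneg zero_le_one fun s hs => mul_nonneg hs.1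
        (density_nonneg (htriangle (Ioo_subset_Icc_self (by simpa using hτ)) hs))
  rw [integral_triangle h (continuousOn_density.mono hsub),
    intervalIntegral.integral_eq_sub_of_hasDerivAt
      (fun τ hτ => hderiv τ (by rwa [uIcc_of_le zero_le_one] at hτ)) hint,
    AffineMap.lineMap_apply_one, AffineMap.lineMap_apply_zero]
  have hapex : hypAngle a (b - a) (c - a) + hypAngle a (c - a) (c - b)
      = hypAngle a (b - a) (c - b) := by
    refine hypAngle_add_hypAngle (gap_pos ha) ?_ ?_ ?_
    · rwa [← orient_apply]
    · rwa [← cross_lineMap_sub a b c 1, AffineMap.lineMap_apply_one] at h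
    · rwa [← cross_lineMap_sub a b c 0, AffineMap.lineMap_apply_zero] at h
  have hfar : hypAngle c (c - b) (a - c) = Real.pi - hypAngle c (a - c) (b - c) := by
    have hpos : 0 < cross (a - c) (b - c) := by rwa [← orient_apply, orient_rotate, orient_rotate]
    rw [← hypAngle_neg_right (gap_pos hc) hpos, ← hypAngle_neg_neg c (b - c), neg_neg, neg_sub]
  simp only [vertexAngle]
  linarith

end Triangle

lemma integral_biUnion_finset_ae {X ι : Type*} [MeasurableSpace X] {μ : Measure X} {E : Type*}
    [NormedAddCommGroup E] [NormedSpace ℝ E] {f : X → E} {t : Finset ι} {s : ι → Set X}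
    (hs : ∀ i ∈ t, NullMeasurableSet (s i) μ)
    (hd : (t : Set ι).Pairwise (Function.onFun (AEDisjoint μ) s))
    (hf : IntegrableOn f (⋃ i ∈ t, s i) μ) :
    ∫ x in ⋃ i ∈ t, s i, f x ∂μ = ∑ i ∈ t, ∫ x in s i, f x ∂μ := by
  have hunion : ⋃ i ∈ t, s i = ⋃ i : t, s i := biUnion_eq_iUnion _ _
  rw [hunion] at hf ⊢
  rw [integral_iUnion_ae (s := fun i : t => s i) (fun i => hs i i.2)
      (fun i j hij => hd i.2 j.2 (Subtype.coe_ne_coe.2 hij)) hf,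
    tsum_fintype, Finset.sum_coe_sort t fun i => ∫ x in s i, f x ∂μ]

lemma addHaar_setOf_affineMap_eq_zero {E F : Type*} [NormedAddCommGroup E] [NormedSpace ℝ E]
    [MeasurableSpace E] [BorelSpace E] [FiniteDimensional ℝ E] (μ : Measure E) [μ.IsAddHaarMeasure]
    [AddCommGroup F] [Module ℝ F] {f : E →ᵃ[ℝ] F} (hf : f ≠ 0) : μ {x | f x = 0} = 0 := by
  have hset : {x | f x = 0} = ((AffineSubspace.mk' (0 : F) ⊥).comap f : Set E) := by
    ext
    simp
  obtain ⟨x, hx⟩ := DFunLike.ne_iff.1 hf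
  rw [hset]
  refine Measure.addHaar_affineSubspace μ _ fun htop => hx ?_
  have : x ∈ (AffineSubspace.mk' (0 : F) ⊥).comap f := htop ▸ AffineSubspace.mem_top ℝ E x
  simpa using this

section GaussBonnet

lemma sum_triangle_defect {m : ℕ} {P : ℕ → ℂ} (hdisk : ∀ i ≤ m, P i ∈ Metric.ball 0 1)
    (hP : ∀ i j k, i < j → j < k → k ≤ m → 0 < orient (P i) (P j) (P k)) {k : ℕ} (hk₂ : 2 ≤ k)
    (hk : k ≤ m) :
    ∑ i ∈ Finset.Ico 1 k, (Real.pi - (vertexAngle (P (i + 1)) (P 0) (P i)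
        + vertexAngle (P 0) (P i) (P (i + 1)) + vertexAngle (P i) (P (i + 1)) (P 0))) =
      (k - 1) * Real.pi - (vertexAngle (P k) (P 0) (P 1) + vertexAngle (P (k - 1)) (P k) (P 0)
        + ∑ i ∈ Finset.Ico 1 k, vertexAngle (P (i - 1)) (P i) (P (i + 1))) := by
  induction k, hk₂ using Nat.le_induction with
  | base =>
    simp only [Nat.Ico_succ_singleton, Finset.sum_singleton, Nat.reduceAdd, Nat.cast_ofNat,
      Nat.add_one_sub_one, tsub_self]
    ring
  | succ k hk₂ ih =>
    have hfirst : vertexAngle (P (k + 1)) (P 0) (P k) + vertexAngle (P k) (P 0) (P 1)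
        = vertexAngle (P (k + 1)) (P 0) (P 1) :=
      vertexAngle_add_vertexAngle (hdisk 0 (by lia)) (hP _ _ _ (by lia) (by lia) hk)
        (hP _ _ _ (by lia) (by lia) (by lia)) (hP _ _ _ (by lia) (by lia) hk)
    have hlast : vertexAngle (P (k - 1)) (P k) (P 0) + vertexAngle (P 0) (P k) (P (k + 1))
        = vertexAngle (P (k - 1)) (P k) (P (k + 1)) := by
      refine vertexAngle_add_vertexAngle (hdisk k (by lia)) ?_ ?_ ?_
      · rw [← orient_rotate]
        exact hP _ _ _ (by lia) (by lia) (by lia)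
      · rw [← orient_rotate, ← orient_rotate]
        exact hP _ _ _ (by lia) (by lia) hk
      · rw [← orient_rotate, ← orient_rotate]
        exact hP _ _ _ (by lia) (by lia) hk
    rw [Finset.sum_Ico_succ_top (by lia), Finset.sum_Ico_succ_top (by lia), ih (by lia),
      Nat.add_sub_cancel]
    push_cast
    linarith

variable {e : ℕ} {p : Fin e → ℂ}

/-- The interior angle of a polygon at its `i`-th vertex. -/
def interiorAngle (p : Fin e → ℂ) (i : Fin e) : ℝ :=
  vertexAngle (p ((finRotate e).symm i)) (p i) (p (finRotate e i))

lemma region_subset_ball (hdisk : ∀ i, p i ∈ Metric.ball 0 1) : region p ⊆ Metric.ball 0 1 :=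
  convexHull_min (range_subset_iff.2 hdisk) (convex_ball 0 1)

lemma integrableOn_density {Q : Set ℂ} (hQ : IsCompact Q) (hsub : Q ⊆ Metric.ball 0 1) :
    IntegrableOn density Q :=
  (continuousOn_density.mono hsub).integrableOn_compact hQ

lemma interiorAngle_eq_vertexAngle [NeZero e] (p : Fin e → ℂ) (i : Fin e) :
    interiorAngle p i = vertexAngle (vertex p (i + (e - 1))) (vertex p i) (vertex p (i + 1)) := by
  have he := i.pos
  obtain ⟨j, rfl⟩ := (finRotate e).surjective i
  have hprev : vertex p (finRotate e j + (e - 1)) = p j := by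
    rw [vertex]
    congr 1
    ext
    rw [Fin.val_ofNat, finRotate_apply, Fin.val_add, Fin.val_one', Nat.add_mod_mod, Nat.mod_add_mod,
      show (j : ℕ) + 1 + (e - 1) = j + e by lia, Nat.add_mod_right, Nat.mod_eq_of_lt j.2]
  rw [interiorAngle, hprev, Equiv.symm_apply_apply, vertex_val, vertex_val_add_one]

lemma sum_interiorAngle [NeZero e] (he : 2 ≤ e) (p : Fin e → ℂ) :
    ∑ i, interiorAngle p i = vertexAngle (vertex p (e - 1)) (vertex p 0) (vertex p 1)
      + vertexAngle (vertex p (e - 1 - 1)) (vertex p (e - 1)) (vertex p 0)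
      + ∑ i ∈ Finset.Ico 1 (e - 1),
          vertexAngle (vertex p (i - 1)) (vertex p i) (vertex p (i + 1)) := by
  obtain ⟨m, rfl⟩ := Nat.exists_eq_add_of_le' he
  have hsum : ∀ i ∈ Finset.Ico 1 (m + 1),
      vertexAngle (vertex p (i + (m + 1))) (vertex p i) (vertex p (i + 1)) =
        vertexAngle (vertex p (i - 1)) (vertex p i) (vertex p (i + 1)) := by
    intro i hi
    rw [show i + (m + 1) = i - 1 + (m + 2) by grind, vertex_periodic p]
  have hlast : vertex p (m + 1 + (m + 1)) = vertex p m ∧ vertex p (m + 1 + 1) = vertex p 0 :=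
    ⟨by rw [show m + 1 + (m + 1) = m + (m + 2) by lia, vertex_periodic p],
      (vertex_periodic p).eq⟩
  simp only [interiorAngle_eq_vertexAngle]
  rw [Fin.sum_univ_eq_sum_range fun i =>
      vertexAngle (vertex p (i + (m + 2 - 1))) (vertex p i) (vertex p (i + 1)),
    Finset.range_eq_Ico, Finset.sum_eq_sum_Ico_succ_bot (by lia), Finset.sum_Ico_succ_top (by lia),
    show m + 2 - 1 = m + 1 by lia, zero_add, zero_add, Finset.sum_congr rfl hsum, hlast.1, hlast.2,
    Nat.add_sub_cancel]
  ring

namespace IsConvexPolygon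

variable [NeZero e]

lemma fan_aedisjoint (hp : IsConvexPolygon p) :
    (Finset.Ico 1 (e - 1) : Set ℕ).Pairwise (Function.onFun (AEDisjoint volume) fun i =>
      convexHull ℝ {vertex p 0, vertex p i, vertex p (i + 1)}) := by
  have hlt {i j : ℕ} (hi : 1 ≤ i) (hij : i < j) (hj : j + 1 < e) :
      AEDisjoint volume (convexHull ℝ {vertex p 0, vertex p i, vertex p (i + 1)})
        (convexHull ℝ {vertex p 0, vertex p j, vertex p (j + 1)}) := by
    let f := orient (vertex p 0) (vertex p j)
    have hright : convexHull ℝ {vertex p 0, vertex p i, vertex p (i + 1)} ⊆ {x | f x ≤ 0} := by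
      refine convexHull_min ?_ ((convex_Iic (0 : ℝ)).affine_preimage f)
      have hback {k : ℕ} (hk : 0 < k) (hkj : k < j) : f (vertex p k) ≤ 0 := by
        rw [orient_swap, ← orient_rotate, neg_nonpos]
        exact (hp.orient_vertex_pos hk hkj (by lia)).le
      rintro _ (rfl | rfl | rfl)
      · exact (orient_apply_left _ _).le
      · exact hback hi hij
      · rcases (Nat.succ_le_of_lt hij).eq_or_lt with rfl | h
        · exact (orient_apply_right _ _).le
        · exact hback i.succ_pos h
    have hleft : convexHull ℝ {vertex p 0, vertex p j, vertex p (j + 1)} ⊆ {x | 0 ≤ f x} := by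
      refine convexHull_min ?_ ((convex_Ici (0 : ℝ)).affine_preimage f)
      rintro _ (rfl | rfl | rfl)
      · exact (orient_apply_left _ _).ge
      · exact (orient_apply_right _ _).ge
      · exact (hp.orient_vertex_pos (by lia) (by lia) hj).le
    have hf : f ≠ 0 := fun h => by
      have := hp.orient_vertex_pos (show 0 < j by lia) j.lt_succ_self hj
      exact this.ne' (DFunLike.congr_fun h _)
    exact measure_mono_null (fun x hx => le_antisymm (hright hx.1) (hleft hx.2))
      (addHaar_setOf_affineMap_eq_zero volume hf)
  intro i hi j hj hij
  rw [Finset.mem_coe, Finset.mem_Ico] at hi hj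
  rcases hij.lt_or_gt with h | h
  · exact hlt hi.1 h (by lia)
  · exact (hlt hj.1 h (by lia)).symm

theorem integral_density_region (hp : IsConvexPolygon p) (hdisk : ∀ i, p i ∈ Metric.ball 0 1) :
    ∫ x in region p, density x = (e - 2) * Real.pi - ∑ i, interiorAngle p i := by
  have he := hp.three_le
  have hsub := region_subset_ball hdisk
  have htriangle : ∀ i ∈ Finset.Ico 1 (e - 1),
      ∫ x in convexHull ℝ {vertex p 0, vertex p i, vertex p (i + 1)}, density x =
        Real.pi - (vertexAngle (vertex p (i + 1)) (vertex p 0) (vertex p i)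
          + vertexAngle (vertex p 0) (vertex p i) (vertex p (i + 1))
          + vertexAngle (vertex p i) (vertex p (i + 1)) (vertex p 0)) := by
    intro i hi
    rw [Finset.mem_Ico] at hi
    exact integral_density_triangle (hdisk _) (hdisk _) (hdisk _)
      (hp.orient_vertex_pos (by lia) (by lia) (by lia))
  have hcast : ((e - 1 : ℕ) : ℝ) - 1 = e - 2 := by
    rw [Nat.cast_sub (by lia)]
    push_cast
    ring
  rw [hp.region_eq_biUnion_fan, integral_biUnion_finset_ae
    (fun i _ => ((toFinite _).isCompact_convexHull ℝ).measurableSet.nullMeasurableSet)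
    hp.fan_aedisjoint (hp.region_eq_biUnion_fan ▸ integrableOn_density (isCompact_region p) hsub),
    Finset.sum_congr rfl htriangle,
    sum_triangle_defect (P := vertex p) (m := e - 1) (fun i _ => hdisk _)
      (fun i j k hij hjk hk => hp.orient_vertex_pos hij hjk (by lia)) (by lia) le_rfl,
    sum_interiorAngle (by lia), hcast]

end IsConvexPolygon

end GaussBonnet

section Geodesic

lemma boundaryPoint_re (φ : ℝ) : (boundaryPoint φ).re = Real.cos φ := exp_ofReal_mul_I_re φ

lemma boundaryPoint_im (φ : ℝ) : (boundaryPoint φ).im = Real.sin φ := exp_ofReal_mul_I_im φ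

lemma norm_boundaryPoint (φ : ℝ) : ‖boundaryPoint φ‖ = 1 := norm_exp_ofReal_mul_I φ

lemma continuous_boundaryPoint : Continuous boundaryPoint := by
  unfold boundaryPoint
  fun_prop

lemma inner_sq_add_cross_sq_boundaryPoint (φ : ℝ) (x : ℂ) :
    ⟪boundaryPoint φ, x⟫ ^ 2 + cross (boundaryPoint φ) x ^ 2 = ‖x‖ ^ 2 := by
  rw [Orientation.inner_sq_add_areaForm_sq, norm_boundaryPoint, one_pow, one_mul]

lemma inner_smul_boundaryPoint_add_cross_smul (φ : ℝ) (x : ℂ) :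
    ⟪boundaryPoint φ, x⟫ • boundaryPoint φ + cross (boundaryPoint φ) x • (I * boundaryPoint φ)
      = x := by
  have hφ := Real.cos_sq_add_sin_sq φ
  rw [inner_apply, cross_apply, boundaryPoint_re, boundaryPoint_im]
  apply Complex.ext
  · simp only [add_re, real_smul, re_ofReal_mul, I_mul_re, boundaryPoint_re, boundaryPoint_im]
    linear_combination x.re * hφ
  · simp only [add_im, real_smul, im_ofReal_mul, I_mul_im, boundaryPoint_re, boundaryPoint_im]
    linear_combination x.im * hφ

lemma boundaryPoint_add_pi (φ : ℝ) : boundaryPoint (φ + Real.pi) = -boundaryPoint φ := by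
  apply Complex.ext <;> simp [boundaryPoint_re, boundaryPoint_im]

lemma geodesic_eq (γ : ℝ × ℝ) (t : ℝ) : geodesic γ t = Real.cos γ.2 • boundaryPoint γ.1
    + ((2 * t - 1) * Real.sin γ.2) • (I * boundaryPoint γ.1) := by
  rw [geodesic, AffineMap.lineMap_apply_module]
  apply Complex.ext
  · simp only [add_re, real_smul, re_ofReal_mul, I_mul_re, boundaryPoint_re, boundaryPoint_im,
      Real.cos_add, Real.cos_sub]
    ring
  · simp only [add_im, real_smul, im_ofReal_mul, I_mul_im, boundaryPoint_re, boundaryPoint_im,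
      Real.sin_add, Real.sin_sub]
    ring

lemma inner_boundaryPoint_geodesic (γ : ℝ × ℝ) (t : ℝ) :
    ⟪boundaryPoint γ.1, geodesic γ t⟫ = Real.cos γ.2 := by
  rw [geodesic_eq, inner_add_right, real_inner_smul_right, real_inner_smul_right,
    real_inner_self_eq_norm_sq, norm_boundaryPoint, inner_apply, I_mul_re, I_mul_im]
  ring

lemma cross_boundaryPoint_geodesic (γ : ℝ × ℝ) (t : ℝ) :
    cross (boundaryPoint γ.1) (geodesic γ t) = (2 * t - 1) * Real.sin γ.2 := by
  rw [geodesic_eq, map_add, map_smul, map_smul, Orientation.areaForm_apply_self, cross_apply,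
    I_mul_re, I_mul_im, boundaryPoint_re, boundaryPoint_im, smul_eq_mul, smul_eq_mul]
  linear_combination (2 * t - 1) * Real.sin γ.2 * Real.cos_sq_add_sin_sq γ.1

lemma gap_geodesic (γ : ℝ × ℝ) (t : ℝ) :
    gap (geodesic γ t) = 4 * Real.sin γ.2 ^ 2 * (t * (1 - t)) := by
  rw [gap, ← inner_sq_add_cross_sq_boundaryPoint γ.1, inner_boundaryPoint_geodesic,
    cross_boundaryPoint_geodesic]
  linear_combination -Real.cos_sq_add_sin_sq γ.2

lemma continuous_geodesic : Continuous fun z : (ℝ × ℝ) × ℝ => geodesic z.1 z.2 := by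
  simp only [geodesic, boundaryPoint, AffineMap.lineMap_apply_module]
  fun_prop

lemma continuous_geodesic_right (γ : ℝ × ℝ) : Continuous (geodesic γ) :=
  AffineMap.lineMap_continuous

lemma deriv_geodesic (γ : ℝ × ℝ) (t : ℝ) :
    deriv (geodesic γ) t = (2 * Real.sin γ.2) • (I * boundaryPoint γ.1) := by
  have h : HasDerivAt (geodesic γ) (boundaryPoint (γ.1 + γ.2) - boundaryPoint (γ.1 - γ.2)) t :=
    AffineMap.hasDerivAt_lineMap
  rw [h.deriv]
  apply Complex.ext
  · simp only [sub_re, real_smul, re_ofReal_mul, I_mul_re, boundaryPoint_re, boundaryPoint_im,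
      Real.cos_add, Real.cos_sub]
    ring
  · simp only [sub_im, real_smul, im_ofReal_mul, I_mul_im, boundaryPoint_re, boundaryPoint_im,
      Real.sin_add, Real.sin_sub]
    ring

variable {γ : ℝ × ℝ} (hγ : γ.2 ∈ Ioo 0 Real.pi)
include hγ

lemma geodesic_mem_ball_iff {t : ℝ} : geodesic γ t ∈ Metric.ball 0 1 ↔ t ∈ Ioo (0 : ℝ) 1 := by
  have hsin := Real.sin_pos_of_mem_Ioo hγ
  have hgap : geodesic γ t ∈ Metric.ball 0 1 ↔ 0 < gap (geodesic γ t) := by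
    rw [mem_ball_zero_iff, gap, sub_pos, sq_lt_one_iff₀ (norm_nonneg _)]
  rw [hgap, gap_geodesic, mul_pos_iff_of_pos_left (by positivity), mem_Ioo]
  constructor
  · intro h
    constructor <;> nlinarith
  · rintro ⟨h₀, h₁⟩
    exact mul_pos h₀ (sub_pos.2 h₁)

lemma sqrt_metric_geodesic {L : ℝ} (hL : 0 ≤ L) {t : ℝ} (ht : t ∈ Ioo (0 : ℝ) 1) :
    √(metric L (geodesic γ t) (deriv (geodesic γ) t) (deriv (geodesic γ) t)) =
      L / (2 * (t * (1 - t))) := by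
  have hsin := Real.sin_pos_of_mem_Ioo hγ
  have ht' : 0 < t * (1 - t) := mul_pos ht.1 (sub_pos.2 ht.2)
  have hnorm : ⟪I * boundaryPoint γ.1, I * boundaryPoint γ.1⟫ = 1 := by
    rw [real_inner_self_eq_norm_sq, norm_mul, norm_I, norm_boundaryPoint]
    norm_num
  have hinner : ⟪geodesic γ t, I * boundaryPoint γ.1⟫ = (2 * t - 1) * Real.sin γ.2 := by
    rw [← cross_boundaryPoint_geodesic, inner_apply, cross_apply]
    simp only [mul_re, mul_im, I_re, I_im, zero_mul, one_mul, zero_sub, zero_add]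
    ring
  have hgram : gram (geodesic γ t) (deriv (geodesic γ) t) (deriv (geodesic γ) t)
      = (2 * Real.sin γ.2 ^ 2) ^ 2 := by
    simp only [gram, deriv_geodesic, real_inner_smul_left, real_inner_smul_right, hnorm, hinner,
      gap_geodesic]
    ring
  have hgap : 0 < gap (geodesic γ t) := gap_pos ((geodesic_mem_ball_iff hγ).2 ht)
  rw [metric_eq_gram_div L hgap.ne', hgram, ← div_pow, ← mul_pow, gap_geodesic,
    Real.sqrt_sq (by positivity)]
  field_simp
  norm_num

lemma croftonDensity_eq (L G : ℝ) {ε : ℝ} (hε : ε ≠ 0) :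
    croftonDensity L G ε γ = L / (4 * G) / Real.sin γ.2 ^ 2 := by
  have hsin {α : ℝ} (hα : α ∈ Ioo 0 Real.pi) := (Real.sin_pos_of_mem_Ioo hα).ne'
  have hderiv {α : ℝ} (hα : α ∈ Ioo 0 Real.pi) :
      HasDerivAt (entropy L G ε) (L / (2 * G) * Real.cot α) α := by
    have := hsin hα
    refine (((((Real.hasDerivAt_sin α).const_mul 2).div_const ε).log (by positivity)).const_mul
      (L / (2 * G))).congr_deriv ?_
    rw [Real.cot_eq_cos_div_sin]
    field_simp
  have hcot : HasDerivAt Real.cot (-1 / Real.sin γ.2 ^ 2) γ.2 := by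
    rw [show Real.cot = fun α => Real.cos α / Real.sin α from funext Real.cot_eq_cos_div_sin]
    refine ((Real.hasDerivAt_cos γ.2).div (Real.hasDerivAt_sin γ.2) (hsin hγ)).congr_deriv ?_
    rw [show -Real.sin γ.2 * Real.sin γ.2 - Real.cos γ.2 * Real.cos γ.2 = -1 by
      linear_combination -Real.sin_sq_add_cos_sq γ.2]
  have hev : deriv (entropy L G ε) =ᶠ[nhds γ.2] fun α => L / (2 * G) * Real.cot α := by
    filter_upwards [Ioo_mem_nhds hγ.1 hγ.2] with α hα using (hderiv hα).deriv
  rw [croftonDensity, iteratedDeriv_succ, iteratedDeriv_one, hev.deriv_eq,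
    (hcot.const_mul _).deriv]
  ring

end Geodesic

section Crofton

lemma hasFDerivAt_geodesic (θ : ℝ) (z : ℝ × ℝ) :
    HasFDerivAt (fun z : ℝ × ℝ => geodesic (θ, z.1) z.2)
      (ofPartials (-Real.sin z.1 • boundaryPoint θ
        + ((2 * z.2 - 1) * Real.cos z.1) • (I * boundaryPoint θ))
        ((2 * Real.sin z.1) • (I * boundaryPoint θ))) z := by
  have hα : HasFDerivAt (fun z : ℝ × ℝ => z.1) (ContinuousLinearMap.fst ℝ ℝ ℝ) z := hasFDerivAt_fst
  have ht : HasFDerivAt (fun z : ℝ × ℝ => z.2) (ContinuousLinearMap.snd ℝ ℝ ℝ) z := hasFDerivAt_snd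
  simp only [geodesic_eq]
  refine ((hα.cos.smul_const _).add
    ((((ht.const_mul 2).sub_const 1).mul hα.sin).smul_const _)).congr_fderiv ?_
  ext <;> simp [ofPartials, mul_comm]

lemma injOn_geodesic (θ : ℝ) :
    InjOn (fun z : ℝ × ℝ => geodesic (θ, z.1) z.2) (Ioo 0 Real.pi ×ˢ Ioo 0 1) := by
  rintro ⟨α, t⟩ ⟨hα, -⟩ ⟨α', t'⟩ ⟨hα', -⟩ h
  obtain rfl : α = α' := by
    refine Real.injOn_cos (Ioo_subset_Icc_self hα) (Ioo_subset_Icc_self hα') ?_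
    rw [← inner_boundaryPoint_geodesic (θ, α) t, ← inner_boundaryPoint_geodesic (θ, α') t']
    exact congrArg _ h
  have hcross := cross_boundaryPoint_geodesic (θ, α) t
  rw [show geodesic (θ, α) t = geodesic (θ, α) t' from h, cross_boundaryPoint_geodesic] at hcross
  have := mul_right_cancel₀ (Real.sin_pos_of_mem_Ioo hα).ne' hcross
  rw [show t = t' by linarith]

lemma exists_geodesic_eq (θ : ℝ) {x : ℂ} (hx : x ∈ Metric.ball 0 1) :
    ∃ α ∈ Ioo 0 Real.pi, ∃ t ∈ Ioo (0 : ℝ) 1, geodesic (θ, α) t = x := by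
  have hinner : ⟪boundaryPoint θ, x⟫ ∈ Ioo (-1 : ℝ) 1 := by
    rw [mem_ball_zero_iff] at hx
    have := abs_real_inner_le_norm (boundaryPoint θ) x
    rw [norm_boundaryPoint, one_mul] at this
    exact abs_lt.1 (this.trans_lt hx)
  set α := Real.arccos ⟪boundaryPoint θ, x⟫ with hα_def
  have hα : α ∈ Ioo 0 Real.pi :=
    ⟨Real.arccos_pos.2 hinner.2, Real.arccos_lt_pi.2 hinner.1⟩
  have hsin := Real.sin_pos_of_mem_Ioo hα
  have heq : geodesic (θ, α) ((cross (boundaryPoint θ) x / Real.sin α + 1) / 2) = x := by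
    conv_rhs => rw [← inner_smul_boundaryPoint_add_cross_smul θ x]
    rw [geodesic_eq, hα_def, Real.cos_arccos hinner.1.le hinner.2.le, ← hα_def]
    congr 2
    field_simp
    ring
  refine ⟨α, hα, _, ?_, heq⟩
  rwa [← geodesic_mem_ball_iff (γ := (θ, α)) hα, heq]

lemma image_geodesic (θ : ℝ) :
    (fun z : ℝ × ℝ => geodesic (θ, z.1) z.2) '' (Ioo 0 Real.pi ×ˢ Ioo 0 1) = Metric.ball 0 1 := by
  ext x
  constructor
  · rintro ⟨⟨α, t⟩, ⟨hα, ht⟩, rfl⟩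
    exact (geodesic_mem_ball_iff (γ := (θ, α)) hα).2 ht
  · intro hx
    obtain ⟨α, hα, t, ht, rfl⟩ := exists_geodesic_eq θ hx
    exact ⟨(α, t), ⟨hα, ht⟩, rfl⟩

lemma lintegral_ball_eq_lintegral_geodesic (θ : ℝ) (f : ℂ → ENNReal) :
    ∫⁻ x in Metric.ball 0 1, f x = ∫⁻ z in Ioo 0 Real.pi ×ˢ Ioo 0 1,
      ENNReal.ofReal (2 * Real.sin z.1 ^ 2) * f (geodesic (θ, z.1) z.2) := by
  have hjac (z : ℝ × ℝ) :
      cross (-Real.sin z.1 • boundaryPoint θ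
        + ((2 * z.2 - 1) * Real.cos z.1) • (I * boundaryPoint θ))
        ((2 * Real.sin z.1) • (I * boundaryPoint θ)) = -(2 * Real.sin z.1 ^ 2) := by
    have h : cross (boundaryPoint θ) (I * boundaryPoint θ) = 1 := by
      rw [cross_apply, I_mul_re, I_mul_im, boundaryPoint_re, boundaryPoint_im]
      linear_combination Real.cos_sq_add_sin_sq θ
    rw [map_add, map_smul, map_smul, map_smul, LinearMap.add_apply, LinearMap.smul_apply,
      LinearMap.smul_apply, h, Orientation.areaForm_apply_self]
    simp only [smul_eq_mul]
    ring
  rw [← image_geodesic θ, lintegral_image_eq_lintegral_cross_mul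
    (measurableSet_Ioo.prod measurableSet_Ioo) (fun z _ => hasFDerivAt_geodesic θ z)
    (injOn_geodesic θ)]
  refine lintegral_congr fun z => ?_
  rw [hjac, abs_neg, abs_of_nonneg (by positivity)]

lemma lintegral_chords_of_direction (θ : ℝ) {f : ℂ → ENNReal} (hf : Measurable f) :
    ∫⁻ α in Ioo 0 Real.pi, ∫⁻ t in Ioo (0 : ℝ) 1,
        ENNReal.ofReal (1 / (Real.sin α ^ 2 * (t * (1 - t)))) * f (geodesic (θ, α) t) =
      ∫⁻ x in Metric.ball 0 1,
        ENNReal.ofReal (2 / (gap x * (1 - ⟪boundaryPoint θ, x⟫ ^ 2))) * f x := by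
  have hgeo : Measurable fun z : ℝ × ℝ => geodesic (θ, z.1) z.2 :=
    (continuous_geodesic.comp
      (by fun_prop : Continuous fun z : ℝ × ℝ => ((θ, z.1), z.2))).measurable
  have hmeas : Measurable fun z : ℝ × ℝ =>
      ENNReal.ofReal (1 / (Real.sin z.1 ^ 2 * (z.2 * (1 - z.2)))) * f (geodesic (θ, z.1) z.2) :=
    Measurable.mul (by fun_prop) (hf.comp hgeo)
  rw [lintegral_ball_eq_lintegral_geodesic θ, Measure.volume_eq_prod,
    ← Measure.prod_restrict, ← lintegral_prod _ hmeas.aemeasurable,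
    Measure.prod_restrict]
  refine setLIntegral_congr_fun (measurableSet_Ioo.prod measurableSet_Ioo) fun z hz => ?_
  have hsin := Real.sin_pos_of_mem_Ioo hz.1
  have : 0 < z.2 * (1 - z.2) := mul_pos hz.2.1 (sub_pos.2 hz.2.2)
  have hsq : 1 - Real.cos z.1 ^ 2 = Real.sin z.1 ^ 2 := by
    linear_combination -Real.cos_sq_add_sin_sq z.1
  rw [gap_geodesic, inner_boundaryPoint_geodesic (θ, z.1), hsq,
    ← mul_assoc (ENNReal.ofReal (2 * _)), ← ENNReal.ofReal_mul (by positivity)]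
  congr 2
  field_simp
  norm_num

lemma sin_sq_add_sq_mul_cos_sq_pos {c : ℝ} (hc : c ≠ 0) (φ : ℝ) :
    0 < Real.sin φ ^ 2 + c ^ 2 * Real.cos φ ^ 2 := by
  have := Real.sin_sq_add_cos_sq φ
  rcases (sq_nonneg (Real.sin φ)).eq_or_lt with h | h
  · have : Real.cos φ ^ 2 = 1 := by linarith
    rw [← h, this]
    positivity
  · positivity

-- On intervals where `tan` is finite the antiderivative is `arctan (tan φ / c) / c`; subtracting
-- `φ = arctan (tan φ)` inside gives an expression that is smooth across the poles of `tan`.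
lemma hasDerivAt_arctan_angular {c : ℝ} (hc : 0 < c) (φ : ℝ) :
    HasDerivAt (fun φ => (φ + Real.arctan ((1 - c) * (Real.sin φ * Real.cos φ) /
        (Real.sin φ ^ 2 + c * Real.cos φ ^ 2))) / c)
      (1 / (Real.sin φ ^ 2 + c ^ 2 * Real.cos φ ^ 2)) φ := by
  have hsc := Real.sin_sq_add_cos_sq φ
  have hden : 0 < Real.sin φ ^ 2 + c * Real.cos φ ^ 2 := by
    simpa [Real.sq_sqrt hc.le] using sin_sq_add_sq_mul_cos_sq_pos (Real.sqrt_pos.2 hc).ne' φ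
  have hden' := sin_sq_add_sq_mul_cos_sq_pos hc.ne' φ
  have hsin := Real.hasDerivAt_sin φ
  have hcos := Real.hasDerivAt_cos φ
  have hquot := ((hsin.mul hcos).const_mul (1 - c)).div
    ((hsin.pow 2).add ((hcos.pow 2).const_mul c)) hden.ne'
  refine (((hasDerivAt_id φ).add hquot.arctan).div_const c).congr_deriv ?_
  simp only [Pi.add_apply, Pi.mul_apply, Pi.pow_apply, Pi.div_apply]
  set s := Real.sin φ
  set k := Real.cos φ
  have hone : 1 + ((1 - c) * (s * k) / (s ^ 2 + c * k ^ 2)) ^ 2 =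
      (s ^ 2 + c ^ 2 * k ^ 2) / (s ^ 2 + c * k ^ 2) ^ 2 := by
    field_simp
    linear_combination (s ^ 2 + c ^ 2 * k ^ 2) * hsc
  rw [hone]
  field_simp
  push_cast
  simp only [pow_one]
  linear_combination ((1 - c) * (c * k ^ 2 - s ^ 2) + c) * hsc

lemma continuous_angular {c : ℝ} (hc : c ≠ 0) :
    Continuous fun φ => 1 / (Real.sin φ ^ 2 + c ^ 2 * Real.cos φ ^ 2) :=
  Continuous.div (by fun_prop) (by fun_prop) fun φ => (sin_sq_add_sq_mul_cos_sq_pos hc φ).ne'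

lemma integral_angular {c : ℝ} (hc : 0 < c) (a : ℝ) :
    ∫ φ in a..a + 2 * Real.pi, 1 / (Real.sin φ ^ 2 + c ^ 2 * Real.cos φ ^ 2)
      = 2 * Real.pi / c := by
  rw [intervalIntegral.integral_eq_sub_of_hasDerivAt (fun φ _ => hasDerivAt_arctan_angular hc φ)
    ((continuous_angular hc.ne').intervalIntegrable _ _), Real.sin_add_two_pi, Real.cos_add_two_pi]
  ring

lemma one_sub_inner_boundaryPoint_sq (θ : ℝ) (x : ℂ) :
    1 - ⟪boundaryPoint θ, x⟫ ^ 2 =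
      Real.sin (θ - x.arg) ^ 2 + gap x * Real.cos (θ - x.arg) ^ 2 := by
  have hinner : ⟪boundaryPoint θ, x⟫ = ‖x‖ * Real.cos (θ - x.arg) := by
    rw [inner_apply, boundaryPoint_re, boundaryPoint_im, Real.cos_sub]
    linear_combination -Real.cos θ * norm_mul_cos_arg x - Real.sin θ * norm_mul_sin_arg x
  rw [hinner, gap]
  linear_combination -Real.sin_sq_add_cos_sq (θ - x.arg)

lemma lintegral_directions {x : ℂ} (hx : x ∈ Metric.ball 0 1) :
    ∫⁻ θ in Ico 0 (2 * Real.pi), ENNReal.ofReal (2 / (gap x * (1 - ⟪boundaryPoint θ, x⟫ ^ 2))) =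
      ENNReal.ofReal (4 * Real.pi * density x) := by
  have hgap := gap_pos hx
  have hc := Real.sqrt_pos.2 hgap
  let g (φ : ℝ) : ℝ := 1 / (Real.sin φ ^ 2 + √(gap x) ^ 2 * Real.cos φ ^ 2)
  have hg (θ : ℝ) :
      2 / (gap x * (1 - ⟪boundaryPoint θ, x⟫ ^ 2)) = 2 / gap x * g (θ - x.arg) := by
    rw [one_sub_inner_boundaryPoint_sq, div_mul_div_comm, mul_one, Real.sq_sqrt hgap.le]
  have hcont : Continuous fun θ => 2 / gap x * g (θ - x.arg) :=
    ((continuous_angular hc.ne').comp (continuous_id.sub continuous_const)).const_mul _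
  have hvalue : ∫ θ in 0..2 * Real.pi, 2 / gap x * g (θ - x.arg) = 4 * Real.pi * density x := by
    rw [intervalIntegral.integral_const_mul, intervalIntegral.integral_comp_sub_right,
      sub_eq_add_neg (2 * _), add_comm (2 * _), zero_sub, integral_angular hc, density]
    field_simp
    norm_num
  simp only [hg]
  rw [← hvalue, intervalIntegral.integral_of_le Real.two_pi_pos.le, restrict_Ico_eq_restrict_Ioc,
    ofReal_integral_eq_lintegral_ofReal]
  · exact (hcont.continuousOn.integrableOn_compact isCompact_Icc).mono_set Ioc_subset_Icc_self
  · refine ae_of_all _ fun θ => ?_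
    have := sin_sq_add_sq_mul_cos_sq_pos hc.ne' (θ - x.arg)
    simp only [Pi.zero_apply, g]
    positivity

lemma measurableSet_kinematicSpace : MeasurableSet kinematicSpace :=
  measurableSet_Ico.prod measurableSet_Ioo

variable {f : ℂ → ENNReal} (hf : Measurable f)
include hf

lemma measurable_lintegral_geodesic : Measurable fun γ : ℝ × ℝ => ∫⁻ t in Ioo (0 : ℝ) 1,
    ENNReal.ofReal (1 / (Real.sin γ.2 ^ 2 * (t * (1 - t)))) * f (geodesic γ t) := by
  refine Measurable.lintegral_prod_right' (f := fun z : (ℝ × ℝ) × ℝ =>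
    ENNReal.ofReal (1 / (Real.sin z.1.2 ^ 2 * (z.2 * (1 - z.2)))) * f (geodesic z.1 z.2)) ?_
  exact Measurable.mul (by fun_prop) (hf.comp continuous_geodesic.measurable)

theorem lintegral_kinematicSpace_lintegral_geodesic :
    ∫⁻ γ in kinematicSpace, ∫⁻ t in Ioo (0 : ℝ) 1,
        ENNReal.ofReal (1 / (Real.sin γ.2 ^ 2 * (t * (1 - t)))) * f (geodesic γ t) =
      ∫⁻ x in Metric.ball 0 1, ENNReal.ofReal (4 * Real.pi * density x) * f x := by
  have hmeas : Measurable fun z : ℝ × ℂ =>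
      ENNReal.ofReal (2 / (gap z.2 * (1 - ⟪boundaryPoint z.1, z.2⟫ ^ 2))) * f z.2 := by
    have := continuous_gap.measurable
    have := continuous_boundaryPoint.measurable
    fun_prop
  rw [kinematicSpace, Measure.volume_eq_prod, ← Measure.prod_restrict,
    lintegral_prod _ (measurable_lintegral_geodesic hf).aemeasurable]
  simp only [lintegral_chords_of_direction _ hf]
  rw [lintegral_lintegral_swap hmeas.aemeasurable]
  refine setLIntegral_congr_fun measurableSet_ball fun x hx => ?_
  have hmeas' : Measurable fun θ =>
      ENNReal.ofReal (2 / (gap x * (1 - ⟪boundaryPoint θ, x⟫ ^ 2))) := by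
    have := continuous_boundaryPoint.measurable
    fun_prop
  rw [lintegral_mul_const _ hmeas', lintegral_directions hx]

end Crofton

section Chord

variable {Q : Set ℂ} {γ : ℝ × ℝ}

lemma times_eq_inter_preimage (Q : Set ℂ) (γ : ℝ × ℝ) :
    times Q γ = geodesic γ ⁻¹' Q ∩ Ioo 0 1 := by
  ext
  exact and_comm

lemma times_eq_preimage (hsub : Q ⊆ Metric.ball 0 1) (hγ : γ.2 ∈ Ioo 0 Real.pi) :
    times Q γ = geodesic γ ⁻¹' Q := by
  rw [times_eq_inter_preimage, inter_eq_left]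
  exact fun t ht => (geodesic_mem_ball_iff hγ).1 (hsub ht)

lemma isCompact_times (hQ : IsCompact Q) (hsub : Q ⊆ Metric.ball 0 1)
    (hγ : γ.2 ∈ Ioo 0 Real.pi) : IsCompact (times Q γ) := by
  have hIcc : times Q γ = Icc 0 1 ∩ geodesic γ ⁻¹' Q := by
    rw [← times_eq_preimage hsub hγ, eq_comm, inter_eq_right]
    exact fun t ht => Ioo_subset_Icc_self ht.1
  rw [hIcc]
  exact isCompact_Icc.inter_right (hQ.isClosed.preimage (continuous_geodesic_right γ))

lemma chord_eq_integral (hQ : MeasurableSet Q) (hγ : γ.2 ∈ Ioo 0 Real.pi) {L : ℝ} (hL : 0 ≤ L) :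
    chord L Q γ = ∫ t in times Q γ, L / (2 * (t * (1 - t))) := by
  refine setIntegral_congr_fun ?_ fun t ht => sqrt_metric_geodesic hγ hL ht.1
  rw [times_eq_inter_preimage]
  exact ((continuous_geodesic_right γ).measurable hQ).inter measurableSet_Ioo

lemma chord_nonneg (L : ℝ) (Q : Set ℂ) (γ : ℝ × ℝ) : 0 ≤ chord L Q γ :=
  integral_nonneg fun _ => Real.sqrt_nonneg _

lemma chord_mul_croftonDensity_nonneg {L G ε : ℝ} (hL : 0 ≤ L) (hG : 0 ≤ G) (hε : ε ≠ 0)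
    (Q : Set ℂ) (hγ : γ.2 ∈ Ioo 0 Real.pi) : 0 ≤ chord L Q γ * croftonDensity L G ε γ := by
  have := chord_nonneg L Q γ
  rw [croftonDensity_eq hγ L G hε]
  positivity

lemma chord_mul_croftonDensity_nonneg_ae {L G ε : ℝ} (hL : 0 ≤ L) (hG : 0 ≤ G) (hε : ε ≠ 0)
    (Q : Set ℂ) :
    0 ≤ᵐ[volume.restrict kinematicSpace] fun γ => chord L Q γ * croftonDensity L G ε γ :=
  ae_restrict_of_forall_mem measurableSet_kinematicSpace fun _ hγ =>
    chord_mul_croftonDensity_nonneg hL hG hε Q hγ.2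

variable (hQ : IsCompact Q) (hsub : Q ⊆ Metric.ball 0 1) {L G ε : ℝ} (hL : 0 ≤ L) (hG : 0 ≤ G)
  (hε : ε ≠ 0)
include hQ hsub hL hG hε

lemma ofReal_chord_mul_croftonDensity (hγ : γ.2 ∈ Ioo 0 Real.pi) :
    ENNReal.ofReal (chord L Q γ * croftonDensity L G ε γ) = ∫⁻ t in Ioo (0 : ℝ) 1,
      ENNReal.ofReal (1 / (Real.sin γ.2 ^ 2 * (t * (1 - t)))) *
        Q.indicator (fun _ => ENNReal.ofReal (L ^ 2 / (8 * G))) (geodesic γ t) := by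
  have hpos {t : ℝ} (ht : t ∈ Ioo (0 : ℝ) 1) : 0 < t * (1 - t) := mul_pos ht.1 (sub_pos.2 ht.2)
  have htimes := isCompact_times hQ hsub hγ
  have hpre := (continuous_geodesic_right γ).measurable hQ.measurableSet
  have hcont : ContinuousOn (fun t => L / (2 * (t * (1 - t)))) (times Q γ) :=
    continuousOn_const.div (by fun_prop) fun t ht => (mul_pos two_pos (hpos ht.1)).ne'
  have hind (t : ℝ) : ENNReal.ofReal (1 / (Real.sin γ.2 ^ 2 * (t * (1 - t)))) *
        Q.indicator (fun _ => ENNReal.ofReal (L ^ 2 / (8 * G))) (geodesic γ t) =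
      (geodesic γ ⁻¹' Q).indicator (fun t => ENNReal.ofReal
        (1 / (Real.sin γ.2 ^ 2 * (t * (1 - t)))) * ENNReal.ofReal (L ^ 2 / (8 * G))) t := by
    by_cases ht : geodesic γ t ∈ Q <;> simp [ht]
  rw [croftonDensity_eq hγ L G hε, chord_eq_integral hQ.measurableSet hγ hL, ← integral_mul_const,
    ofReal_integral_eq_lintegral_ofReal ((hcont.integrableOn_compact htimes).mul_const _)]
  · simp only [hind]
    rw [setLIntegral_indicator hpre, ← times_eq_inter_preimage]
    refine setLIntegral_congr_fun htimes.measurableSet fun t ht => ?_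
    have := hpos ht.1
    rw [← ENNReal.ofReal_mul (by positivity)]
    congr 1
    generalize t * (1 - t) = w
    ring
  · refine ae_restrict_of_forall_mem htimes.measurableSet fun t ht => ?_
    have := hpos ht.1
    simp only [Pi.zero_apply]
    positivity

lemma lintegral_chord :
    ∫⁻ γ in kinematicSpace, ENNReal.ofReal (chord L Q γ * croftonDensity L G ε γ) =
      ENNReal.ofReal (Real.pi / (2 * G) * area L Q) := by
  have hind (x : ℂ) : ENNReal.ofReal (4 * Real.pi * density x) *
        Q.indicator (fun _ => ENNReal.ofReal (L ^ 2 / (8 * G))) x =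
      Q.indicator (fun x => ENNReal.ofReal (4 * Real.pi * density x) *
        ENNReal.ofReal (L ^ 2 / (8 * G))) x := by
    by_cases hx : x ∈ Q <;> simp [hx]
  rw [setLIntegral_congr_fun measurableSet_kinematicSpace fun γ hγ =>
      ofReal_chord_mul_croftonDensity hQ hsub hL hG hε hγ.2,
    lintegral_kinematicSpace_lintegral_geodesic (measurable_const.indicator hQ.measurableSet)]
  simp only [hind]
  rw [setLIntegral_indicator hQ.measurableSet, inter_eq_left.2 hsub,
    lintegral_mul_const _ (measurable_density.const_mul _).ennreal_ofReal,
    ← ofReal_integral_eq_lintegral_ofReal ((integrableOn_density hQ hsub).const_mul _),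
    integral_const_mul, ← ENNReal.ofReal_mul', area_eq_integral_density L hQ.measurableSet hsub]
  · congr 1
    ring
  · positivity
  · refine ae_restrict_of_forall_mem hQ.measurableSet fun x hx => ?_
    have := density_nonneg (hsub hx)
    simp only [Pi.zero_apply]
    positivity

theorem integrableOn_chord :
    IntegrableOn (fun γ => chord L Q γ * croftonDensity L G ε γ) kinematicSpace := by
  refine ⟨?_, ?_⟩
  · refine AEMeasurable.aestronglyMeasurable ⟨_, (measurable_lintegral_geodesic
      ((measurable_const (a := ENNReal.ofReal (L ^ 2 / (8 * G)))).indicator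
        hQ.measurableSet)).ennreal_toReal, ?_⟩
    refine ae_restrict_of_forall_mem measurableSet_kinematicSpace fun γ hγ => ?_
    beta_reduce
    rw [← ofReal_chord_mul_croftonDensity hQ hsub hL hG hε hγ.2,
      ENNReal.toReal_ofReal (chord_mul_croftonDensity_nonneg hL hG hε Q hγ.2)]
  · rw [hasFiniteIntegral_iff_ofReal (chord_mul_croftonDensity_nonneg_ae hL hG hε Q),
      lintegral_chord hQ hsub hL hG hε]
    exact ENNReal.ofReal_lt_top

theorem integral_chord :
    ∫ γ in kinematicSpace, chord L Q γ * croftonDensity L G ε γ =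
      Real.pi / (2 * G) * area L Q := by
  have harea : 0 ≤ area L Q := integral_nonneg fun _ => Real.sqrt_nonneg _
  rw [integral_eq_lintegral_of_nonneg_ae (chord_mul_croftonDensity_nonneg_ae hL hG hε Q)
    (integrableOn_chord hQ hsub hL hG hε).aestronglyMeasurable,
    lintegral_chord hQ hsub hL hG hε, ENNReal.toReal_ofReal (by positivity)]

end Chord

section Reversal

/-- The reversal of orientation of a geodesic, up to a full turn of the angle `θ`. -/
def reversal : ℝ × ℝ ≃ᵐ ℝ × ℝ :=
  (MeasurableEquiv.addRight Real.pi).prodCongr (MeasurableEquiv.subLeft Real.pi)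

lemma reversal_apply (γ : ℝ × ℝ) : reversal γ = (γ.1 + Real.pi, Real.pi - γ.2) := rfl

lemma measurePreserving_reversal : MeasurePreserving reversal :=
  (measurePreserving_add_right volume Real.pi).prod
    (Measure.measurePreserving_sub_left volume Real.pi)

lemma reversal_snd_mem_Ioo {γ : ℝ × ℝ} :
    (reversal γ).2 ∈ Ioo 0 Real.pi ↔ γ.2 ∈ Ioo 0 Real.pi := by
  rw [reversal_apply, mem_Ioo, mem_Ioo, sub_pos, sub_lt_self_iff, and_comm]

lemma geodesic_reversal (γ : ℝ × ℝ) (t : ℝ) : geodesic (reversal γ) t = geodesic γ (1 - t) := by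
  rw [geodesic_eq, geodesic_eq, reversal_apply, boundaryPoint_add_pi, Real.cos_pi_sub,
    Real.sin_pi_sub, mul_neg, neg_smul_neg, smul_neg, ← neg_smul]
  congr 2
  ring

lemma times_reversal (Q : Set ℂ) (γ : ℝ × ℝ) :
    times Q (reversal γ) = (fun t => 1 - t) ⁻¹' times Q γ := by
  ext t
  simp only [times, mem_ofPred_eq, mem_preimage, geodesic_reversal, mem_Ioo, sub_pos,
    sub_lt_self_iff, and_comm (a := 0 < t)]

lemma isGreatest_times_iff {Q : Set ℂ} {γ : ℝ × ℝ} {t : ℝ} :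
    IsGreatest (times Q γ) t ↔ IsLeast (times Q (reversal γ)) (1 - t) := by
  rw [times_reversal]
  constructor
  · rintro ⟨ht, hmax⟩
    exact ⟨by simpa using ht, fun s hs => sub_le_comm.1 (hmax hs)⟩
  · rintro ⟨ht, hmin⟩
    exact ⟨by simpa using ht, fun s hs => sub_le_sub_iff_left 1 |>.1 (hmin (by simpa using hs))⟩

lemma chord_reversal {L : ℝ} (hL : 0 ≤ L) {Q : Set ℂ} (hQ : MeasurableSet Q) {γ : ℝ × ℝ}
    (hγ : γ.2 ∈ Ioo 0 Real.pi) : chord L Q (reversal γ) = chord L Q γ := by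
  rw [chord_eq_integral hQ hγ hL, chord_eq_integral hQ (reversal_snd_mem_Ioo.2 hγ) hL,
    times_reversal, ← (Measure.measurePreserving_sub_left (volume : Measure ℝ) 1)
      |>.setIntegral_preimage_emb (MeasurableEquiv.subLeft (1 : ℝ)).measurableEmbedding _
        (times Q γ)]
  simp only [sub_sub_cancel, mul_comm]

lemma croftonDensity_reversal (L G : ℝ) {ε : ℝ} (hε : ε ≠ 0) {γ : ℝ × ℝ}
    (hγ : γ.2 ∈ Ioo 0 Real.pi) : croftonDensity L G ε (reversal γ) = croftonDensity L G ε γ := by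
  rw [croftonDensity_eq hγ L G hε, croftonDensity_eq (reversal_snd_mem_Ioo.2 hγ) L G hε,
    reversal_apply, Real.sin_pi_sub]

end Reversal

section Offset

/-- The affine function of `x` which vanishes on the geodesic `γ` and is positive on its right. -/
def offset (γ : ℝ × ℝ) : ℂ →ᵃ[ℝ] ℝ :=
  (innerₗ ℂ (boundaryPoint γ.1)).toAffineMap - AffineMap.const ℝ ℂ (Real.cos γ.2)

lemma offset_apply (γ : ℝ × ℝ) (x : ℂ) :
    offset γ x = ⟪boundaryPoint γ.1, x⟫ - Real.cos γ.2 := rfl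

lemma offset_geodesic (γ : ℝ × ℝ) (t : ℝ) : offset γ (geodesic γ t) = 0 := by
  rw [offset_apply, inner_boundaryPoint_geodesic, sub_self]

lemma exists_geodesic_eq_of_offset_eq_zero {γ : ℝ × ℝ} (hγ : γ.2 ∈ Ioo 0 Real.pi) {x : ℂ}
    (hx : x ∈ Metric.ball 0 1) (h : offset γ x = 0) : ∃ t ∈ Ioo (0 : ℝ) 1, geodesic γ t = x := by
  obtain ⟨α, hα, t, ht, rfl⟩ := exists_geodesic_eq γ.1 hx
  rw [offset_apply, inner_boundaryPoint_geodesic (γ.1, α), sub_eq_zero] at h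
  obtain rfl := Real.injOn_cos (Ioo_subset_Icc_self hα) (Ioo_subset_Icc_self hγ) h
  exact ⟨t, ht, rfl⟩

lemma measurable_offset (x : ℂ) : Measurable fun γ => offset γ x := by
  simp only [offset_apply]
  exact (((continuous_boundaryPoint.comp continuous_fst).inner continuous_const).sub
    (Real.continuous_cos.comp continuous_snd)).measurable

lemma measurableSet_snd_mem_Ioo : MeasurableSet {γ : ℝ × ℝ | γ.2 ∈ Ioo 0 Real.pi} :=
  measurable_snd measurableSet_Ioo

lemma volume_setOf_offset_eq_zero (x : ℂ) :
    volume {γ : ℝ × ℝ | γ.2 ∈ Ioo 0 Real.pi ∧ offset γ x = 0} = 0 := by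
  have hmeas : MeasurableSet {γ : ℝ × ℝ | γ.2 ∈ Ioo 0 Real.pi ∧ offset γ x = 0} :=
    measurableSet_snd_mem_Ioo.inter (measurable_offset x (measurableSet_singleton 0))
  rw [Measure.volume_eq_prod, Measure.measure_prod_null hmeas]
  refine ae_of_all _ fun θ => Set.Subsingleton.measure_zero ?_ _
  rintro α ⟨hα, h⟩ α' ⟨hα', h'⟩
  rw [offset_apply] at h h'
  exact Real.injOn_cos (Ioo_subset_Icc_self hα) (Ioo_subset_Icc_self hα') (by linarith)

end Offset

section Sector

variable {e : ℕ} {p : Fin e → ℂ} {γ : ℝ × ℝ}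

/-- The geodesics through a vertex, over all angles `θ`. -/
def vertexGeodesics (p : Fin e → ℂ) : Set (ℝ × ℝ) :=
  ⋃ k, {γ | γ.2 ∈ Ioo 0 Real.pi ∧ offset γ (p k) = 0}

/-- The geodesics which enter the polygon through the `i`-th edge, over all angles `θ`. A sector
consists of the geodesics in the entry set of one edge whose reversals are in that of another. -/
def entrySet (p : Fin e → ℂ) (i : Fin e) : Set (ℝ × ℝ) :=
  {γ | γ.2 ∈ Ioo 0 Real.pi ∧ ∃ s, IsLeast (times (region p) γ) s ∧ geodesic γ s ∈ edge p i}

/-- The geodesics which cross the `i`-th edge strictly between its end points, from the outside of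
the polygon to the inside. Up to null sets this is the entry set, but it is visibly measurable. -/
def inwardSet (p : Fin e → ℂ) (i : Fin e) : Set (ℝ × ℝ) :=
  {γ | γ.2 ∈ Ioo 0 Real.pi ∧ offset γ (p i) < 0 ∧ 0 < offset γ (p (finRotate e i))}

lemma volume_vertexGeodesics (p : Fin e → ℂ) : volume (vertexGeodesics p) = 0 :=
  measure_iUnion_null fun k => volume_setOf_offset_eq_zero (p k)

lemma mem_vertexGeodesics (hγ : γ.2 ∈ Ioo 0 Real.pi) {t : ℝ} (h : geodesic γ t ∈ range p) :
    γ ∈ vertexGeodesics p := by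
  obtain ⟨k, hk⟩ := h
  exact mem_iUnion.2 ⟨k, hγ, by rw [hk, offset_geodesic]⟩

lemma measurableSet_inwardSet (p : Fin e → ℂ) (i : Fin e) : MeasurableSet (inwardSet p i) :=
  measurableSet_snd_mem_Ioo.inter
    ((measurableSet_lt (measurable_offset _) measurable_const).inter
      (measurableSet_lt measurable_const (measurable_offset _)))

lemma reversal_reversal_mem_entrySet {i : Fin e} :
    reversal (reversal γ) ∈ entrySet p i ↔ γ ∈ entrySet p i := by
  simp only [entrySet, mem_ofPred_eq, reversal_snd_mem_Ioo, times_reversal, preimage_preimage,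
    geodesic_reversal, sub_sub_cancel, preimage_id']

lemma sector_eq (p : Fin e → ℂ) (i j : Fin e) :
    sector p i j = kinematicSpace ∩ (entrySet p i ∩ reversal ⁻¹' entrySet p j) := by
  ext γ
  have hexit : (∃ t, IsGreatest (times (region p) γ) t ∧ geodesic γ t ∈ edge p j) ↔
      ∃ s, IsLeast (times (region p) (reversal γ)) s ∧ geodesic (reversal γ) s ∈ edge p j := by
    rw [(Equiv.subLeft (1 : ℝ)).surjective.exists]
    simp only [isGreatest_times_iff, geodesic_reversal, Equiv.subLeft_apply, sub_sub_cancel]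
  rw [sector, mem_ofPred_eq, hexit]
  refine and_congr_right fun hγ => ?_
  rw [mem_inter_iff, mem_preimage, entrySet, entrySet, mem_ofPred_eq, mem_ofPred_eq,
    reversal_snd_mem_Ioo, and_iff_right hγ.2, and_iff_right hγ.2]

lemma side_geodesic (p : Fin e → ℂ) (γ : ℝ × ℝ) (i : Fin e) (s t : ℝ) :
    side p i (geodesic γ t) = side p i (geodesic γ s) +
      2 * Real.sin γ.2 * (t - s) * (offset γ (p (finRotate e i)) - offset γ (p i)) := by
  simp only [geodesic_eq, orient_apply, cross_apply, offset_apply, inner_apply, sub_re, sub_im,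
    add_re, add_im, real_smul, re_ofReal_mul, im_ofReal_mul, I_mul_re, I_mul_im]
  ring

lemma exists_mem_edge_offset_lt (hp : IsConvexPolygon p) (hγ : γ.2 ∈ Ioo 0 Real.pi) {s : ℝ}
    (hs : IsLeast (times (region p) γ) s) :
    ∃ i, geodesic γ s ∈ edge p i ∧ offset γ (p i) < offset γ (p (finRotate e i)) := by
  have hsin := Real.sin_pos_of_mem_Ioo hγ
  -- Otherwise the geodesic is in the polygon shortly before `s`.
  by_contra! hcon
  have hside : ∀ᶠ t in nhdsWithin s (Iio s), ∀ i, 0 ≤ side p i (geodesic γ t) := by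
    rw [Filter.eventually_all]
    intro i
    rcases (hp.side_nonneg i hs.1.2).eq_or_lt with hzero | hpos
    · have hslope := sub_nonpos.2 (hcon i (hp.mem_edge hs.1.2 hzero.symm))
      filter_upwards [self_mem_nhdsWithin] with t ht
      rw [side_geodesic p γ i s t, ← hzero, zero_add]
      exact mul_nonneg_of_nonpos_of_nonpos
        (mul_nonpos_of_nonneg_of_nonpos (by positivity) (sub_nonpos.2 (le_of_lt ht))) hslope
    · have hcont := (continuous_orient (p i) (p (finRotate e i))).comp (continuous_geodesic_right γ)
      exact ((hcont.tendsto s).eventually_const_le hpos).filter_mono nhdsWithin_le_nhds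
  have hIoo : ∀ᶠ t in nhdsWithin s (Iio s), t ∈ Ioo (0 : ℝ) 1 :=
    nhdsWithin_le_nhds (Ioo_mem_nhds hs.1.1.1 hs.1.1.2)
  obtain ⟨t, ht, htIoo, hts⟩ := (hside.and (hIoo.and self_mem_nhdsWithin)).exists
  have : NeZero e := ⟨by have := hp.three_le; lia⟩
  exact (hs.2 ⟨htIoo, hp.mem_region_of_side_nonneg ht⟩).not_gt hts

lemma exists_mem_entrySet (hp : IsConvexPolygon p) (hsub : region p ⊆ Metric.ball 0 1)
    (hγ : γ.2 ∈ Ioo 0 Real.pi) (hne : (times (region p) γ).Nonempty) :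
    ∃ i, γ ∈ entrySet p i ∧ offset γ (p i) < offset γ (p (finRotate e i)) := by
  obtain ⟨s, hs⟩ := (isCompact_times (isCompact_region p) hsub hγ).exists_isLeast hne
  obtain ⟨i, hi, hlt⟩ := exists_mem_edge_offset_lt hp hγ hs
  exact ⟨i, ⟨hγ, s, hs, hi⟩, hlt⟩

lemma entrySet_inter_subset (hp : IsConvexPolygon p) {i k : Fin e} (hik : i ≠ k) :
    entrySet p i ∩ entrySet p k ⊆ vertexGeodesics p := by
  rintro γ ⟨⟨hγ, s, hs, hi⟩, -, s', hs', hk⟩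
  obtain rfl := hs.unique hs'
  exact mem_vertexGeodesics hγ (hp.mem_range_of_mem_edges hik hi hk)

lemma inwardSet_subset_entrySet (hp : IsConvexPolygon p) (hsub : region p ⊆ Metric.ball 0 1)
    (i : Fin e) : inwardSet p i ⊆ entrySet p i := by
  rintro γ ⟨hγ, hneg, hpos⟩
  have hsin := Real.sin_pos_of_mem_Ioo hγ
  obtain ⟨r, hr, hzero⟩ : ∃ r ∈ Icc (0 : ℝ) 1,
      offset γ (AffineMap.lineMap (p i) (p (finRotate e i)) r) = 0 := by
    have hcont : Continuous fun r : ℝ =>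
        offset γ (AffineMap.lineMap (p i) (p (finRotate e i)) r) := by
      simp only [AffineMap.apply_lineMap]
      exact AffineMap.lineMap_continuous
    refine intermediate_value_Icc zero_le_one hcont.continuousOn ?_
    rw [AffineMap.lineMap_apply_zero, AffineMap.lineMap_apply_one]
    exact ⟨hneg.le, hpos.le⟩
  have hedge : AffineMap.lineMap (p i) (p (finRotate e i)) r ∈ edge p i := by
    rw [edge, segment_eq_image_lineMap]
    exact mem_image_of_mem _ hr
  have hregion := edge_subset_region i hedge
  obtain ⟨s, hs, heq⟩ := exists_geodesic_eq_of_offset_eq_zero hγ (hsub hregion) hzero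
  rw [← heq] at hedge hregion
  refine ⟨hγ, s, ⟨⟨hs, hregion⟩, fun t ht => ?_⟩, hedge⟩
  have hside := hp.side_nonneg i ht.2
  rw [side_geodesic p γ i s t, side_eq_zero_of_mem_edge hedge, zero_add] at hside
  have := nonneg_of_mul_nonneg_left hside (by linarith)
  exact sub_nonneg.1 (nonneg_of_mul_nonneg_right this (by positivity))

lemma entrySet_sdiff_inwardSet_subset (hp : IsConvexPolygon p)
    (hsub : region p ⊆ Metric.ball 0 1) (i : Fin e) :
    entrySet p i \ inwardSet p i ⊆ vertexGeodesics p := by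
  rintro γ ⟨hentry, hnot⟩
  have hγ := hentry.1
  obtain ⟨s, hs, hi⟩ := hentry.2
  by_contra hvertex
  have hne (k : Fin e) : offset γ (p k) ≠ 0 := fun h => hvertex (mem_iUnion.2 ⟨k, hγ, h⟩)
  obtain ⟨k, hk, hlt⟩ := exists_mem_entrySet hp hsub hγ ⟨s, hs.1⟩
  obtain rfl : i = k := by
    by_contra h
    exact hvertex (entrySet_inter_subset hp h ⟨hentry, hk⟩)
  have hzero := offset_geodesic γ s
  rw [edge, segment_eq_image_lineMap] at hi
  obtain ⟨r, ⟨hr₀, hr₁⟩, hr⟩ := hi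
  rw [← hr, AffineMap.apply_lineMap, AffineMap.lineMap_apply_ring] at hzero
  have hneg : offset γ (p i) ≤ 0 := by nlinarith
  have hpos : 0 ≤ offset γ (p (finRotate e i)) := by nlinarith
  exact hnot ⟨hγ, hneg.lt_of_ne (hne i), hpos.lt_of_ne (hne _).symm⟩

lemma nullMeasurableSet_entrySet (hp : IsConvexPolygon p) (hsub : region p ⊆ Metric.ball 0 1)
    (i : Fin e) : NullMeasurableSet (entrySet p i) := by
  refine (measurableSet_inwardSet p i).nullMeasurableSet.congr (ae_eq_set.2 ⟨?_, ?_⟩)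
  · rw [sdiff_eq_empty.2 (inwardSet_subset_entrySet hp hsub i), measure_empty]
  · exact measure_mono_null (entrySet_sdiff_inwardSet_subset hp hsub i) (volume_vertexGeodesics p)

lemma nullMeasurableSet_sector (hp : IsConvexPolygon p) (hsub : region p ⊆ Metric.ball 0 1)
    (i j : Fin e) : NullMeasurableSet (sector p i j) := by
  have h := nullMeasurableSet_entrySet hp hsub
  rw [sector_eq]
  exact measurableSet_kinematicSpace.nullMeasurableSet.inter
    ((h i).inter ((h j).preimage measurePreserving_reversal.quasiMeasurePreserving))

lemma sector_aedisjoint (hp : IsConvexPolygon p) {i j k l : Fin e} (h : (i, j) ≠ (k, l)) :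
    AEDisjoint volume (sector p i j) (sector p k l) := by
  rw [AEDisjoint, sector_eq, sector_eq]
  by_cases hik : i = k
  · have hjl : j ≠ l := fun hjl => h (by rw [hik, hjl])
    refine measure_mono_null ?_ (measurePreserving_reversal.quasiMeasurePreserving.preimage_null
      (volume_vertexGeodesics p))
    exact fun γ hγ => entrySet_inter_subset hp hjl ⟨hγ.1.2.2, hγ.2.2.2⟩
  · refine measure_mono_null ?_ (volume_vertexGeodesics p)
    exact fun γ hγ => entrySet_inter_subset hp hik ⟨hγ.1.2.1, hγ.2.2.1⟩

lemma offset_reversal (γ : ℝ × ℝ) (x : ℂ) : offset (reversal γ) x = -offset γ x := by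
  rw [offset_apply, offset_apply, reversal_apply, boundaryPoint_add_pi, inner_neg_left,
    Real.cos_pi_sub]
  ring

lemma mem_geodesicsMeeting {Q : Set ℂ} :
    γ ∈ geodesicsMeeting Q ↔ γ ∈ kinematicSpace ∧ (times Q γ).Nonempty := by
  refine and_congr_right fun _ => ?_
  rw [image_inter_nonempty_iff]
  rfl

theorem geodesicsMeeting_eq (hp : IsConvexPolygon p) (hsub : region p ⊆ Metric.ball 0 1) :
    geodesicsMeeting (region p) = ⋃ (i) (j) (_ : i ≠ j), sector p i j := by
  ext γ
  simp only [mem_geodesicsMeeting, mem_iUnion, exists_prop, sector_eq]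
  constructor
  · rintro ⟨hγ, hne⟩
    have hγ' := reversal_snd_mem_Ioo.2 hγ.2
    have hne' : (times (region p) (reversal γ)).Nonempty := by
      rw [times_reversal]
      exact hne.preimage (Equiv.subLeft (1 : ℝ)).surjective
    obtain ⟨i, hi, hlt⟩ := exists_mem_entrySet hp hsub hγ.2 hne
    obtain ⟨j, hj, hlt'⟩ := exists_mem_entrySet hp hsub hγ' hne'
    rw [offset_reversal, offset_reversal, neg_lt_neg_iff] at hlt'
    exact ⟨i, j, fun h => (h ▸ hlt).asymm hlt', hγ, hi, hj⟩
  · rintro ⟨i, j, -, hγ, ⟨-, s, hs, -⟩, -⟩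
    exact ⟨hγ, s, hs.1⟩

end Sector

section SectorIntegral

lemma two_mul_sum_Ioi {ι : Type*} [LinearOrder ι] [Fintype ι] [LocallyFiniteOrderTop ι]
    {f : ι → ι → ℝ} (hf : ∀ i j, f i j = f j i) :
    2 * ∑ i, ∑ j ∈ Finset.Ioi i, f i j = ∑ q ∈ Finset.univ.offDiag, f q.1 q.2 := by
  have hlt : ∑ q ∈ Finset.univ.offDiag with q.1 < q.2, f q.1 q.2 =
      ∑ i, ∑ j ∈ Finset.Ioi i, f i j :=
    Finset.sum_finset_product _ _ _ fun q => by simpa using ne_of_lt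
  have hgt : ∑ q ∈ Finset.univ.offDiag with ¬ q.1 < q.2, f q.1 q.2 =
      ∑ j, ∑ i ∈ Finset.Ioi j, f i j :=
    Finset.sum_finset_product_right _ _ _ fun q => by
      simp only [Finset.mem_filter, Finset.mem_offDiag, Finset.mem_univ, Finset.mem_Ioi, true_and,
        not_lt]
      exact ⟨fun h => h.2.lt_of_ne' h.1, fun h => ⟨h.ne', h.le⟩⟩
  rw [← Finset.sum_filter_add_sum_filter_not _ fun q : ι × ι => q.1 < q.2, hlt, hgt, two_mul]
  exact congrArg _ (Finset.sum_congr rfl fun i _ => Finset.sum_congr rfl fun j _ => hf i j)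

variable {e : ℕ} {p : Fin e → ℂ} (hp : IsConvexPolygon p) (hsub : region p ⊆ Metric.ball 0 1)
  {L G ε : ℝ}

lemma sector_subset_kinematicSpace (p : Fin e → ℂ) (i j : Fin e) :
    sector p i j ⊆ kinematicSpace := fun _ hγ => hγ.1

lemma integrableOn_weightedChord (hsub : region p ⊆ Metric.ball 0 1) (hL : 0 ≤ L) (hG : 0 ≤ G)
    (hε : ε ≠ 0) : IntegrableOn (weightedChord L G ε p) kinematicSpace :=
  integrableOn_chord (isCompact_region p) hsub hL hG hε

lemma weightedChord_reversal (p : Fin e → ℂ) (hL : 0 ≤ L) (G : ℝ) (hε : ε ≠ 0) {γ : ℝ × ℝ}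
    (hγ : γ.2 ∈ Ioo 0 Real.pi) :
    weightedChord L G ε p (reversal γ) = weightedChord L G ε p γ := by
  rw [weightedChord, weightedChord, chord_reversal hL (isCompact_region p).measurableSet hγ,
    croftonDensity_reversal L G hε hγ]

lemma preimage_reversal_sector (p : Fin e → ℂ) (i j : Fin e) :
    reversal ⁻¹' (sector p j i \ {γ | γ.1 < Real.pi}) = sector p i j ∩ {γ | γ.1 < Real.pi} := by
  ext γ
  have hspace : reversal γ ∈ kinematicSpace ∧ ¬ (reversal γ).1 < Real.pi ↔
      γ ∈ kinematicSpace ∧ γ.1 < Real.pi := by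
    rw [kinematicSpace, mem_prod, mem_prod, reversal_snd_mem_Ioo]
    simp only [mem_Ico, reversal_apply]
    have := Real.pi_pos
    constructor
    · rintro ⟨⟨⟨-, hlt⟩, hα⟩, hnot⟩
      exact ⟨⟨⟨by linarith, by linarith⟩, hα⟩, by linarith⟩
    · rintro ⟨⟨⟨hle, -⟩, hα⟩, hlt⟩
      exact ⟨⟨⟨by linarith, by linarith⟩, hα⟩, by linarith⟩
  simp only [sector_eq, mem_preimage, mem_sdiff, mem_inter_iff, mem_ofPred_eq,
    reversal_reversal_mem_entrySet]
  tauto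

include hp hsub

lemma integral_sector_inter_lt_pi (hL : 0 ≤ L) (G : ℝ) (hε : ε ≠ 0) (i j : Fin e) :
    ∫ γ in sector p i j ∩ {γ | γ.1 < Real.pi}, weightedChord L G ε p γ =
      ∫ γ in sector p j i \ {γ | γ.1 < Real.pi}, weightedChord L G ε p γ := by
  have hmeas : NullMeasurableSet (sector p i j ∩ {γ | γ.1 < Real.pi}) :=
    (nullMeasurableSet_sector hp hsub i j).inter
      (measurableSet_lt measurable_fst measurable_const).nullMeasurableSet
  rw [← measurePreserving_reversal.setIntegral_preimage_emb reversal.measurableEmbedding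
    (weightedChord L G ε p) (sector p j i \ _), preimage_reversal_sector]
  refine integral_congr_ae ?_
  filter_upwards [ae_restrict_mem₀ hmeas] with γ hγ
  exact (weightedChord_reversal p hL G hε hγ.1.1.2).symm

theorem sectorIntegral_comm (hL : 0 ≤ L) (hG : 0 ≤ G) (hε : ε ≠ 0) (i j : Fin e) :
    sectorIntegral L G ε p i j = sectorIntegral L G ε p j i := by
  have hmeas : MeasurableSet {γ : ℝ × ℝ | γ.1 < Real.pi} :=
    measurableSet_lt measurable_fst measurable_const
  have hint (i j : Fin e) : IntegrableOn (weightedChord L G ε p) (sector p i j) :=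
    (integrableOn_weightedChord hsub hL hG hε).mono_set (sector_subset_kinematicSpace p i j)
  rw [sectorIntegral, sectorIntegral, ← integral_inter_add_sdiff hmeas (hint i j),
    ← integral_inter_add_sdiff hmeas (hint j i), integral_sector_inter_lt_pi hp hsub hL G hε,
    integral_sector_inter_lt_pi hp hsub hL G hε, add_comm]

lemma integral_geodesicsMeeting (hL : 0 ≤ L) (hG : 0 ≤ G) (hε : ε ≠ 0) :
    ∫ γ in geodesicsMeeting (region p), weightedChord L G ε p γ =
      ∑ q ∈ Finset.univ.offDiag, ∫ γ in sector p q.1 q.2, weightedChord L G ε p γ := by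
  have hunion : geodesicsMeeting (region p) =
      ⋃ q ∈ Finset.univ.offDiag, sector p q.1 q.2 := by
    rw [geodesicsMeeting_eq hp hsub]
    ext γ
    simp
  rw [hunion, integral_biUnion_finset_ae
    (fun q _ => nullMeasurableSet_sector hp hsub q.1 q.2)
    (fun q _ r _ hqr => sector_aedisjoint hp hqr)
    ((integrableOn_weightedChord hsub hL hG hε).mono_set
      (iUnion₂_subset fun q _ => sector_subset_kinematicSpace p q.1 q.2))]

theorem two_mul_sum_sectorIntegral (hL : 0 ≤ L) (hG : 0 < G) (hε : ε ≠ 0) :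
    2 * ∑ i, ∑ j ∈ Finset.Ioi i, sectorIntegral L G ε p i j = area L (region p) := by
  have hmeeting : ∫ γ in kinematicSpace, weightedChord L G ε p γ =
      ∫ γ in geodesicsMeeting (region p), weightedChord L G ε p γ := by
    refine setIntegral_eq_of_subset_of_forall_sdiff_eq_zero measurableSet_kinematicSpace
      (fun γ hγ => hγ.1) fun γ hγ => ?_
    have htimes : times (region p) γ = ∅ := by
      by_contra h
      exact hγ.2 (mem_geodesicsMeeting.2 ⟨hγ.1, nonempty_iff_ne_empty.2 h⟩)
    rw [weightedChord, chord, htimes, setIntegral_empty, zero_mul]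
  rw [two_mul_sum_Ioi (sectorIntegral_comm hp hsub hL hG.le hε)]
  simp only [sectorIntegral]
  rw [← Finset.mul_sum, ← integral_geodesicsMeeting hp hsub hL hG.le hε, ← hmeeting]
  simp only [weightedChord]
  rw [integral_chord (isCompact_region p) hsub hL hG.le hε]
  have := Real.pi_pos
  field_simp

omit hsub in
theorem area_region (hdisk : ∀ i, p i ∈ Metric.ball 0 1) (L : ℝ) :
    area L (region p) = L ^ 2 * ((e - 2) * Real.pi - ∑ i, interiorAngle p i) := by
  have : NeZero e := ⟨by have := hp.three_le; lia⟩
  rw [area_eq_integral_density L (isCompact_region p).measurableSet (region_subset_ball hdisk),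
    hp.integral_density_region hdisk]

end SectorIntegral

section RightAngledPolygon

variable {e : ℕ} {p : Fin e → ℂ} {L : ℝ}

lemma isConvexPolygon_of_isRightAngledPolygon (he : 3 ≤ e) (hp : IsRightAngledPolygon L p) :
    IsConvexPolygon p where
  three_le := he
  side_pos i j hi hj := by
    have hside := hp.convex i j hi hj
    rwa [← Complex.areaForm, ← orient_apply] at hside

lemma interiorAngle_eq_pi_div_two (he : 3 ≤ e) (hL : L ≠ 0) (hp : IsRightAngledPolygon L p)
    (i : Fin e) : interiorAngle p i = Real.pi / 2 := by
  have hgap : 0 < gap (p i) := gap_pos (mem_ball_zero_iff.2 (hp.mem_disk i))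
  have hprev : 0 < side p i (p ((finRotate e).symm i)) := by
    refine (isConvexPolygon_of_isRightAngledPolygon he hp).side_pos i _ (fun h => ?_) fun h => ?_
    · have hfix : finRotate e i = i := ((Equiv.symm_apply_eq _).1 h).symm
      exact finRotate_finRotate_ne he i (by rw [hfix, hfix])
    · exact finRotate_finRotate_ne he i ((Equiv.symm_apply_eq _).1 h).symm
  have hgram : gram (p i) (p (finRotate e i) - p i) (p ((finRotate e).symm i) - p i) = 0 := by
    have hangle := hp.right_angle i
    rw [metric_eq_gram_div L hgap.ne'] at hangle
    simpa only [mul_eq_zero, div_eq_zero_iff, pow_eq_zero_iff two_ne_zero, hL, hgap.ne', false_or,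
      or_false] using hangle
  rw [side, orient_apply] at hprev
  exact hypAngle_eq_pi_div_two hgap hprev hgram

end RightAngledPolygon

theorem mainTheorem3_general {e : ℕ} {p : Fin e → ℂ} (hp : IsConvexPolygon p)
    (hdisk : ∀ i, p i ∈ Metric.ball 0 1) {L G ε : ℝ} (hL : 0 < L) (hG : 0 < G) (hε : 0 < ε) :
    (geodesicsMeeting (region p) = ⋃ (i) (j) (_ : i ≠ j), sector p i j) ∧
    (∀ i j k l, (i, j) ≠ (k, l) → AEDisjoint volume (sector p i j) (sector p k l)) ∧
    (∀ i j, IntegrableOn (weightedChord L G ε p) (sector p i j)) ∧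
    (∀ i j, sectorIntegral L G ε p i j = sectorIntegral L G ε p j i) ∧
    2 * ∑ i, ∑ j ∈ Finset.Ioi i, sectorIntegral L G ε p i j =
      L ^ 2 * ((e - 2) * Real.pi - ∑ i, interiorAngle p i) ∧
    area L (region p) = 2 * ∑ i, ∑ j ∈ Finset.Ioi i, sectorIntegral L G ε p i j := by
  have hsub := region_subset_ball hdisk
  have hsum := two_mul_sum_sectorIntegral hp hsub hL.le hG hε.ne'
  exact ⟨geodesicsMeeting_eq hp hsub, fun _ _ _ _ h => sector_aedisjoint hp h,
    fun i j => (integrableOn_weightedChord hsub hL.le hG.le hε.ne').mono_set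
      (sector_subset_kinematicSpace p i j),
    sectorIntegral_comm hp hsub hL.le hG.le hε.ne',
    hsum.trans (area_region hp hdisk L), hsum.symm⟩

end

end KinematicSpace

open KinematicSpace in
theorem mainTheorem3 (n : ℕ) (hn : 2 ≤ n) (L G ε : ℝ) (hL : 0 < L) (hG : 0 < G) (hε : 0 < ε)
    (p : Fin (4 * (n - 1)) → ℂ) (hp : IsRightAngledPolygon L p) :
    (geodesicsMeeting (region p) = ⋃ (i) (j) (_ : i ≠ j), sector p i j) ∧
    (∀ i j k l, i ≠ j → k ≠ l → (i, j) ≠ (k, l) →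
      MeasureTheory.AEDisjoint MeasureTheory.volume (sector p i j) (sector p k l)) ∧
    (∀ i j, i ≠ j → MeasureTheory.IntegrableOn (weightedChord L G ε p) (sector p i j)) ∧
    (∀ i j, i ≠ j → sectorIntegral L G ε p i j = sectorIntegral L G ε p j i) ∧
    2 * ∑ i, ∑ j ∈ Finset.Ioi i, sectorIntegral L G ε p i j =
      2 * Real.pi * ((n : ℝ) - 2) * L ^ 2 ∧
    area L (region p) = 2 * ∑ i, ∑ j ∈ Finset.Ioi i, sectorIntegral L G ε p i j := by
  have he : 3 ≤ 4 * (n - 1) := by lia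
  have hcast : ((4 * (n - 1) : ℕ) : ℝ) = 4 * (n - 1) := by
    rw [Nat.cast_mul, Nat.cast_sub (by lia), Nat.cast_ofNat, Nat.cast_one]
  obtain ⟨hcover, hdisjoint, hintegrable, hcomm, hsum, harea⟩ :=
    mainTheorem3_general (isConvexPolygon_of_isRightAngledPolygon he hp)
      (fun i => mem_ball_zero_iff.2 (hp.mem_disk i)) hL hG hε
  refine ⟨hcover, fun i j k l _ _ => hdisjoint i j k l, fun i j _ => hintegrable i j,
    fun i j _ => hcomm i j, hsum.trans ?_, harea⟩
  simp only [interiorAngle_eq_pi_div_two he hL.ne' hp, Finset.sum_const, Finset.card_univ,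
    Fintype.card_fin, nsmul_eq_mul, hcast]
  ring
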